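/- Let $c>1$ be a real number and $t\ge 0$ an integer. For $n\ge c$ let $X\sim X(n,c/n)$ be the clique complex of the Erdős–Rényi random graph $G(n,c/n)$ (each of the $\binom n2$ possible edges is present independently with probability $c/n$). A vertex $v$ of a simplicial complex $K$ is *dominated* if its link in $K$ is a simplicial cone, i.e. $\mathrm{lk}_K(v)=aL=\{\{a\}\}\cup L\cup\{\sigma\cup\{a\}:\sigma\in L\}$ for some vertex $a\neq v$ and some (possibly empty) subcomplex $L$ of $K$ not containing $a$. A *pruning phase* on $K$ simultaneously removes all dominated vertices of $K$, together with all simplices containing one of them. Let $R_t(K)$ be the complex obtained from $K$ by $t$ successive pruning phases, and let $f_0(K)$ be the set of non-isolated vertices of $K$, i.e. of the vertices that lie in an edge of $K$. Then there are constants $A,B\ge 0$, depending only on $c$ and $t$, such that for all integers $n\ge c$ and all real $s\ge 0$, $$\Pr\Big\{\big|\,|f_0(R_t(X))|-\mathbb E|f_0(R_t(X))|\,\big|\ \ge\ s\,n^{2/3}\Big\}\ \le\ 2\exp\!\left(-\frac{s^2 n^{1/3}}{c\,4^{t+1}+\tfrac23\,s\,n^{-1/3}\,2^{t+1}+A/n}\right)+\frac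 Bn ,$$ and for every fixed $s>0$ the right-hand side tends to $0$ as $n\to\infty$. -/

import Mathlib

open MeasureTheory Filter Topology
open scoped SimpleGraph

namespace StrongCollapse

/-- The clique (flag) complex of a graph: its simplices are the nonempty finite cliques. -/
def cliqueComplex {V : Type*} (G : SimpleGraph V) : PreAbstractSimplicialComplex V where
  faces := {s | s.Nonempty ∧ G.IsClique (s : Set V)}
  isRelLowerSet_faces := fun _ hs =>
    ⟨hs.1, fun _ hts ht => ⟨ht, hs.2.subset (Finset.coe_subset.2 hts)⟩⟩

/-- The link of `σ` in `K`: the simplices `τ` of `K` with `τ ∪ σ ∈ K` and `τ ∩ σ = ∅`. -/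
def link {V : Type*} [DecidableEq V] (K : PreAbstractSimplicialComplex V) (σ : Finset V) :
    PreAbstractSimplicialComplex V where
  faces := {τ | τ ∈ K ∧ τ ∪ σ ∈ K ∧ Disjoint τ σ}
  isRelLowerSet_faces := fun _ hτ =>
    ⟨(K.isRelLowerSet_faces hτ.1).1, fun _ hρ hne =>
      ⟨(K.isRelLowerSet_faces hτ.1).2 hρ hne,
        (K.isRelLowerSet_faces hτ.2.1).2 (Finset.union_subset_union_left hρ)
          (hne.mono Finset.subset_union_left),
        hτ.2.2.mono_left hρ⟩⟩

/-- The simplicial cone `aL` with apex `a` over `L`: the vertex `a`, the simplices of `L`, and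
the simplices `σ ∪ {a}` with `σ ∈ L`. The base `L` may be empty; then the cone is the point `a`. -/
def cone {V : Type*} [DecidableEq V] (a : V) (L : PreAbstractSimplicialComplex V) :
    PreAbstractSimplicialComplex V where
  faces := {τ | τ = {a} ∨ τ ∈ L ∨ ∃ σ ∈ L, τ = insert a σ}
  isRelLowerSet_faces := by
    have hL : ∀ σ ∈ L, ∀ ρ : Finset V, ρ ⊆ σ → ρ.Nonempty → ρ ∈ L :=
      fun σ hσ ρ h hne => (L.isRelLowerSet_faces hσ).2 h hne
    rintro τ (rfl | hτ | ⟨σ, hσ, rfl⟩)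
    · exact ⟨Finset.singleton_nonempty a, fun ρ hρ hne =>
        Or.inl ((Finset.subset_singleton_iff.1 hρ).resolve_left hne.ne_empty)⟩
    · exact ⟨(L.isRelLowerSet_faces hτ).1, fun ρ hρ hne => Or.inr (Or.inl (hL τ hτ ρ hρ hne))⟩
    · refine ⟨Finset.insert_nonempty a σ, fun ρ hρ hne => ?_⟩
      have hsub : ρ.erase a ⊆ σ := Finset.subset_insert_iff.1 hρ
      by_cases ha : a ∈ ρ
      · rcases (ρ.erase a).eq_empty_or_nonempty with h0 | h1
        · left
          rw [← Finset.insert_erase ha, h0]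
          rfl
        · exact Or.inr (Or.inr ⟨ρ.erase a, hL σ hσ _ hsub h1, (Finset.insert_erase ha).symm⟩)
      · rw [Finset.erase_eq_of_notMem ha] at hsub
        exact Or.inr (Or.inl (hL σ hσ ρ hsub hne))

/-- The simplex `σ` of `K` is dominated by the vertex `a ∉ σ`: the link of `σ` is a cone `aL`
for a subcomplex `L` of `K` that does not have `a` as a vertex. -/
def DominatedBy {V : Type*} [DecidableEq V] (K : PreAbstractSimplicialComplex V)
    (σ : Finset V) (a : V) : Prop :=
  σ ∈ K ∧ a ∉ σ ∧ ∃ L : PreAbstractSimplicialComplex V, L ≤ K ∧ {a} ∉ L ∧ link K σ = cone a L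

/-- A dominated (strong-collapsible) vertex. -/
def IsDominatedVertex {V : Type*} [DecidableEq V] (K : PreAbstractSimplicialComplex V)
    (v : V) : Prop :=
  ∃ a : V, DominatedBy K {v} a

/-- One pruning phase: all dominated vertices of `K` are removed simultaneously, together with
all simplices containing one of them. -/
def prune {V : Type*} [DecidableEq V] (K : PreAbstractSimplicialComplex V) :
    PreAbstractSimplicialComplex V where
  faces := {τ | τ ∈ K ∧ ∀ v ∈ τ, ¬ IsDominatedVertex K v}
  isRelLowerSet_faces := fun _ hτ =>
    ⟨(K.isRelLowerSet_faces hτ.1).1, fun _ hρ hne =>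
      ⟨(K.isRelLowerSet_faces hτ.1).2 hρ hne, fun v hv => hτ.2 v (hρ hv)⟩⟩

/-- The complex `R_t(K)` left after `t` pruning phases. -/
def afterPhases {V : Type*} [DecidableEq V] (t : ℕ) (K : PreAbstractSimplicialComplex V) :
    PreAbstractSimplicialComplex V :=
  prune^[t] K

/-- The set `f₀(K)` of non-isolated vertices of `K`, i.e. the endpoints of edges of `K`. -/
def nonIsolated {V : Type*} [DecidableEq V] (K : PreAbstractSimplicialComplex V) : Set V :=
  {v | ∃ w : V, w ≠ v ∧ {v, w} ∈ K}

/-- The number `|f₀(R_t(cl(G)))|` of non-isolated vertices left in the clique complex of `G`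
after `t` pruning phases. -/
noncomputable def survivors {V : Type*} [DecidableEq V] (t : ℕ) (G : SimpleGraph V) : ℝ :=
  ((nonIsolated (afterPhases t (cliqueComplex G))).ncard : ℝ)

/-- The expression
`2 exp (-s² n^{1/3} / (c 4^{t+1} + (2/3) s n^{-1/3} 2^{t+1} + A/n)) + B/n`. -/
noncomputable def tailBound (c : ℝ) (t : ℕ) (A B : ℝ) (n : ℕ) (s : ℝ) : ℝ :=
  2 * Real.exp (-(s ^ 2 * (n : ℝ) ^ (1 / 3 : ℝ) /
    (c * 4 ^ (t + 1) + (2 / 3) * s * (n : ℝ) ^ (-(1 / 3) : ℝ) * 2 ^ (t + 1) + A / n))) + B / n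

end StrongCollapse

/-! Up to a small error, pruning is peeling: repeated removal of the vertices with at most one
neighbour left. A vertex with a single neighbour left is dominated, so `peelSupport` contains the
survivors. A dominated vertex with two neighbours left lies in a triangle, so once all edges meeting
triangles are deleted, peeling leaves no more than pruning. Both facts use that pruning keeps a
clique complex a clique complex.

Adding an edge `uv` changes the peeling count by at most `2 (t + 1)`: a removed vertex has at most
one neighbour that outlives it (`exists_peel_successor`), so the rescued vertices lie on two chains
of successors that start at `u` and `v`. Hence pruning and peeling differ by at most `2 (t + 1)`
times the number of paws (triangles with a marked edge at a corner). The union of two paws has at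
least as many edges as vertices, so this number has bounded second moment, and it reaches order `√n`
with probability only `O(1/n)`. This is the term `B/n`.

Bernstein's inequality over the independent edges concentrates the peeling count, with variance
proxy `c n / 2 * (2 (t + 1)) ^ 2`, against the target `c n / 2 * 4 ^ (t + 1)`. A constant factor of
slack must pay for the passage from pruning to peeling. For `t ≥ 2` it comes from `2 (t + 1) < 2 ^
(t + 1)`; for `t = 0` the passage is exact. For `t = 1` there is equality, and the gain comes from
averaging: `uv` changes the count by `4` only if `u` is a leaf, which fails with probability bounded
below (`peelSupport_one_concentration`). Deviations below `√n` are trivial and those above `n`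
impossible, so an error of small order `√n` costs a small fraction of `x`. The constant `A = 0`
works. -/

namespace StrongCollapse

/-! ### Averages over independent Bernoulli coordinates -/

section BernoulliAverage

variable {ι : Type*} [DecidableEq ι]

/-- The average of `f` when the elements of `u` are resampled independently, each one being
present with probability `p`, and the other elements stay as they are in `S`. -/
noncomputable def bernoulliAvg (p : ℝ) (u : Finset ι) (f : Finset ι → ℝ) (S : Finset ι) : ℝ :=
  ∑ T ∈ u.powerset, p ^ T.card * (1 - p) ^ (u \ T).card * f (T ∪ S \ u)

lemma bernoulliAvg_empty (p : ℝ) (f : Finset ι → ℝ) : bernoulliAvg p ∅ f = f := by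
  ext S
  simp [bernoulliAvg]

/-- Splitting the subsets `T` by whether `e ∈ T` exposes one coordinate; the inductions on `u` rest
on this. -/
lemma bernoulliAvg_insert (p : ℝ) {u : Finset ι} {e : ι} (he : e ∉ u) (f : Finset ι → ℝ)
    (S : Finset ι) :
    bernoulliAvg p (insert e u) f S =
      p * bernoulliAvg p u f (insert e S) + (1 - p) * bernoulliAvg p u f (S.erase e) := by
  unfold bernoulliAvg
  rw [Finset.sum_powerset_insert he, add_comm, Finset.mul_sum, Finset.mul_sum]
  congr 1
  · refine Finset.sum_congr rfl fun T hT => ?_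
    have hT' := Finset.mem_powerset.1 hT
    have heT : e ∉ T := fun h => he (hT' h)
    have h1 : insert e u \ insert e T = u \ T := by
      ext x; simp only [Finset.mem_sdiff, Finset.mem_insert]; grind
    have h2 : insert e T ∪ S \ insert e u = T ∪ insert e S \ u := by
      ext x; simp only [Finset.mem_union, Finset.mem_sdiff, Finset.mem_insert]; grind
    rw [h1, h2, Finset.card_insert_of_notMem heT]
    ring
  · refine Finset.sum_congr rfl fun T hT => ?_
    have hT' := Finset.mem_powerset.1 hT
    have heT : e ∉ T := fun h => he (hT' h)
    have h1 : insert e u \ T = insert e (u \ T) := by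
      ext x; simp only [Finset.mem_sdiff, Finset.mem_insert]; grind
    have h2 : T ∪ S \ insert e u = T ∪ S.erase e \ u := by
      ext x; simp only [Finset.mem_union, Finset.mem_sdiff, Finset.mem_insert, Finset.mem_erase]
      grind
    rw [h1, h2, Finset.card_insert_of_notMem (by simp [he])]
    ring

/-- Fubini: independent coordinates may be averaged in stages. -/
lemma bernoulliAvg_union (p : ℝ) {u v : Finset ι} (h : Disjoint u v) (f : Finset ι → ℝ) :
    bernoulliAvg p (u ∪ v) f = bernoulliAvg p u (bernoulliAvg p v f) := by
  induction u using Finset.induction_on with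
  | empty => simp [bernoulliAvg_empty]
  | insert e u he ih =>
    rw [Finset.disjoint_insert_left] at h
    ext S
    rw [Finset.insert_union, bernoulliAvg_insert p (by simp [he, h.1]), ih h.2,
      bernoulliAvg_insert p he]

lemma bernoulliAvg_const (p : ℝ) (u : Finset ι) (a : ℝ) (S : Finset ι) :
    bernoulliAvg p u (fun _ => a) S = a := by
  induction u using Finset.induction_on generalizing S with
  | empty => simp [bernoulliAvg_empty]
  | insert e u he ih =>
    rw [bernoulliAvg_insert p he, ih, ih]
    ring

lemma bernoulliAvg_mono {p : ℝ} (h0 : 0 ≤ p) (h1 : p ≤ 1) (u : Finset ι) {f g : Finset ι → ℝ}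
    (h : ∀ S, f S ≤ g S) (S : Finset ι) : bernoulliAvg p u f S ≤ bernoulliAvg p u g S := by
  refine Finset.sum_le_sum fun T _ => mul_le_mul_of_nonneg_left (h _) ?_
  have := sub_nonneg.2 h1
  positivity

lemma bernoulliAvg_sub (p : ℝ) (u : Finset ι) (f g : Finset ι → ℝ) (S : Finset ι) :
    bernoulliAvg p u (fun S => f S - g S) S = bernoulliAvg p u f S - bernoulliAvg p u g S := by
  simp [bernoulliAvg, mul_sub, Finset.sum_sub_distrib]

lemma bernoulliAvg_const_mul (p : ℝ) (u : Finset ι) (a : ℝ) (f : Finset ι → ℝ) (S : Finset ι) :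
    bernoulliAvg p u (fun S => a * f S) S = a * bernoulliAvg p u f S := by
  simp only [bernoulliAvg, Finset.mul_sum]
  exact Finset.sum_congr rfl fun T _ => by ring

lemma bernoulliAvg_neg (p : ℝ) (u : Finset ι) (f : Finset ι → ℝ) (S : Finset ι) :
    bernoulliAvg p u (fun S => - f S) S = - bernoulliAvg p u f S := by
  simp [bernoulliAvg, Finset.sum_neg_distrib]

/-- Averaging over `u` commutes with taking the discrete derivative at an element outside `u`. -/
lemma bernoulliAvg_insert_sub_erase (p : ℝ) {u : Finset ι} {e : ι} (he : e ∉ u)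
    (f : Finset ι → ℝ) (S : Finset ι) :
    bernoulliAvg p u f (insert e S) - bernoulliAvg p u f (S.erase e) =
      bernoulliAvg p u (fun S => f (insert e S) - f (S.erase e)) S := by
  unfold bernoulliAvg
  rw [← Finset.sum_sub_distrib]
  refine Finset.sum_congr rfl fun T hT => ?_
  have heT : e ∉ T := fun h => he (Finset.mem_powerset.1 hT h)
  have h1 : T ∪ insert e S \ u = insert e (T ∪ S \ u) := by
    ext x; simp only [Finset.mem_union, Finset.mem_sdiff, Finset.mem_insert]; grind
  have h2 : T ∪ S.erase e \ u = (T ∪ S \ u).erase e := by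
    ext x; simp only [Finset.mem_union, Finset.mem_sdiff, Finset.mem_erase]; grind
  rw [h1, h2]
  ring

lemma bernoulliAvg_le_of_le {p : ℝ} (h0 : 0 ≤ p) (h1 : p ≤ 1) (u : Finset ι) {f : Finset ι → ℝ}
    {a : ℝ} (h : ∀ S, f S ≤ a) (S : Finset ι) : bernoulliAvg p u f S ≤ a :=
  (bernoulliAvg_mono h0 h1 u h S).trans_eq (bernoulliAvg_const p u a S)

lemma le_bernoulliAvg_of_le {p : ℝ} (h0 : 0 ≤ p) (h1 : p ≤ 1) (u : Finset ι) {f : Finset ι → ℝ}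
    {a : ℝ} (h : ∀ S, a ≤ f S) (S : Finset ι) : a ≤ bernoulliAvg p u f S :=
  (bernoulliAvg_const p u a S).symm.trans_le (bernoulliAvg_mono h0 h1 u h S)

/-- A prescribed finite set `F ⊆ u` is present with probability `p ^ |F|`. -/
lemma bernoulliAvg_superset (p : ℝ) {u F : Finset ι} (hF : F ⊆ u) (S : Finset ι) :
    bernoulliAvg p u (fun S => if F ⊆ S then 1 else 0) S = p ^ F.card := by
  have key : bernoulliAvg p F (fun S => if F ⊆ S then (1 : ℝ) else 0) = fun _ => p ^ F.card := by
    ext S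
    unfold bernoulliAvg
    rw [Finset.sum_eq_single F]
    · simp
    · intro T hT hne
      have : ¬ F ⊆ T ∪ S \ F := fun h => hne <| (Finset.mem_powerset.1 hT).antisymm fun x hx => by
        have := h hx
        simp only [Finset.mem_union, Finset.mem_sdiff] at this
        tauto
      simp [this]
    · simp
  rw [← Finset.sdiff_union_of_subset hF, bernoulliAvg_union p Finset.sdiff_disjoint, key,
    bernoulliAvg_const]

end BernoulliAverage

/-! ### Bernstein's bound for the moment generating function -/

section Bernstein

variable {ι : Type*} [DecidableEq ι]

/-- Since `(k + 2)! ≥ 2 * 3 ^ k`, the Taylor tail of `exp` is dominated by a geometric series of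
ratio `x / 3`. -/
lemma exp_sub_one_sub_le {x y : ℝ} (hxy : |y| ≤ x) (hx : x < 3) :
    Real.exp y - 1 - y ≤ x ^ 2 / (2 * (1 - x / 3)) := by
  have hx0 : 0 ≤ x := (abs_nonneg y).trans hxy
  have h1 : HasSum (fun k : ℕ => y ^ (k + 2) / ((k + 2).factorial : ℝ)) (Real.exp y - 1 - y) := by
    have h := NormedSpace.expSeries_div_hasSum_exp (𝔸 := ℝ) y
    rw [← Real.exp_eq_exp_ℝ] at h
    have := (hasSum_nat_add_iff' 2).2 h
    simpa [Finset.sum_range_succ, sub_sub] using this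
  have h2 : HasSum (fun k : ℕ => x ^ 2 / 2 * (x / 3) ^ k) (x ^ 2 / 2 * (1 - x / 3)⁻¹) :=
    (hasSum_geometric_of_lt_one (by positivity) (by linarith)).mul_left _
  have h3 : x ^ 2 / (2 * (1 - x / 3)) = x ^ 2 / 2 * (1 - x / 3)⁻¹ := by
    rw [div_mul_eq_div_div, div_eq_mul_inv (x ^ 2 / 2)]
  rw [h3]
  refine hasSum_le (fun k => ?_) h1 h2
  have hfac : (2 * 3 ^ k : ℝ) ≤ ((k + 2).factorial : ℝ) := by
    induction k with
    | zero => norm_num [Nat.factorial]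
    | succ k ih =>
      rw [show k + 1 + 2 = (k + 2) + 1 by ring, Nat.factorial_succ]
      push_cast
      have hk : (0 : ℝ) ≤ k := Nat.cast_nonneg k
      have : (0 : ℝ) < 3 ^ k := by positivity
      calc (2 * 3 ^ (k + 1) : ℝ) = 3 * (2 * 3 ^ k) := by ring
        _ ≤ (k + 2 + 1) * ((k + 2).factorial : ℝ) := by gcongr; linarith
  calc y ^ (k + 2) / ((k + 2).factorial : ℝ)
      ≤ |y| ^ (k + 2) / ((k + 2).factorial : ℝ) := by
        refine div_le_div_of_nonneg_right ?_ (by positivity)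
        rw [← abs_pow]
        exact le_abs_self _
    _ ≤ x ^ (k + 2) / (2 * 3 ^ k) := by gcongr
    _ = x ^ 2 / 2 * (x / 3) ^ k := by rw [div_pow]; field_simp; ring

/-- Bernstein's bound for the moment generating function of a function of independent Bernoulli
variables that changes by at most `L` when one of them changes. -/
lemma bernoulliAvg_exp_le {p : ℝ} (h0 : 0 ≤ p) (h1 : p ≤ 1) {f : Finset ι → ℝ} {L θ : ℝ}
    (hθ : 0 ≤ θ) (hL : θ * L < 3) (u : Finset ι)
    (hf : ∀ e ∈ u, ∀ S, |f (insert e S) - f (S.erase e)| ≤ L) (S : Finset ι) :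
    bernoulliAvg p u (fun S => Real.exp (θ * f S)) S ≤
      Real.exp (θ * bernoulliAvg p u f S +
        p * u.card * ((θ * L) ^ 2 / (2 * (1 - θ * L / 3)))) := by
  set ψ := (θ * L) ^ 2 / (2 * (1 - θ * L / 3)) with hψ
  induction u using Finset.induction_on generalizing S with
  | empty => simp [bernoulliAvg_empty]
  | insert e u he ih =>
    have ih' := ih fun e' he' => hf e' (Finset.mem_insert_of_mem he')
    set a := bernoulliAvg p u f (insert e S) with ha
    set b := bernoulliAvg p u f (S.erase e) with hb
    have hab : |a - b| ≤ L := by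
      rw [ha, hb, bernoulliAvg_insert_sub_erase p he]
      have hd := hf e (Finset.mem_insert_self e u)
      exact abs_le.2 ⟨le_bernoulliAvg_of_le h0 h1 u (fun S => (abs_le.1 (hd S)).1) S,
        bernoulliAvg_le_of_le h0 h1 u (fun S => (abs_le.1 (hd S)).2) S⟩
    have hy : |θ * (a - b)| ≤ θ * L := by
      rw [abs_mul, abs_of_nonneg hθ]
      gcongr
    have hψ' := exp_sub_one_sub_le hy hL
    have hq := sub_nonneg.2 h1
    rw [bernoulliAvg_insert p he, bernoulliAvg_insert p he, Finset.card_insert_of_notMem he,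
      ← ha, ← hb]
    set m := p * (u.card : ℝ) * ψ with hm
    calc p * bernoulliAvg p u (fun S => Real.exp (θ * f S)) (insert e S) +
          (1 - p) * bernoulliAvg p u (fun S => Real.exp (θ * f S)) (S.erase e)
        ≤ p * Real.exp (θ * a + m) + (1 - p) * Real.exp (θ * b + m) := by
          gcongr
          · exact ih' (insert e S)
          · exact ih' (S.erase e)
      _ = Real.exp (θ * b + m) * (1 + p * (Real.exp (θ * (a - b)) - 1)) := by
          rw [show θ * a + m = (θ * b + m) + θ * (a - b) by ring, Real.exp_add _ (θ * (a - b))]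
          ring
      -- As `p a + (1 - p) b = b + p (a - b)`, the mean passes into the exponent and the coordinate
      -- costs `p ψ`; the inequality is `1 + z ≤ exp z`.
      _ ≤ Real.exp (θ * b + m) * Real.exp (p * (ψ + θ * (a - b))) := by
          gcongr
          calc 1 + p * (Real.exp (θ * (a - b)) - 1) ≤ p * (ψ + θ * (a - b)) + 1 := by
                nlinarith
            _ ≤ _ := Real.add_one_le_exp _
      _ = _ := by
          rw [← Real.exp_add]
          congr 1
          push_cast
          ring

/-- A two-stage form of `bernoulliAvg_exp_le`: averaging over `u` first may improve the bound on
the differences along `w`. -/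
lemma bernoulliAvg_exp_le_of_disjoint {p : ℝ} (h0 : 0 ≤ p) (h1 : p ≤ 1) {f : Finset ι → ℝ}
    {L M V θ : ℝ} (hθ : 0 ≤ θ) (hL : θ * L < 3) (hML : M ≤ L) {u w : Finset ι}
    (huw : Disjoint u w)
    (hu : ∀ e ∈ u, ∀ S, |f (insert e S) - f (S.erase e)| ≤ L)
    (hw : ∀ e ∈ w, ∀ S, |bernoulliAvg p u (fun S => f (insert e S) - f (S.erase e)) S| ≤ M)
    (hV : p * (u.card * L ^ 2 + w.card * M ^ 2) ≤ V) (S : Finset ι) :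
    bernoulliAvg p (w ∪ u) (fun S => Real.exp (θ * f S)) S ≤
      Real.exp (θ * bernoulliAvg p (w ∪ u) f S + θ ^ 2 * V / (2 * (1 - θ * L / 3))) := by
  rw [bernoulliAvg_union p huw.symm, bernoulliAvg_union p huw.symm]
  set m := p * u.card * ((θ * L) ^ 2 / (2 * (1 - θ * L / 3)))
  have hMθ : θ * M ≤ θ * L := by gcongr
  have hpos : 0 < 1 - θ * L / 3 := by linarith
  calc _ ≤ bernoulliAvg p w
        (fun S => Real.exp m * Real.exp (θ * bernoulliAvg p u f S)) S := by
        refine bernoulliAvg_mono h0 h1 w (fun S => ?_) S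
        rw [← Real.exp_add, add_comm m]
        exact bernoulliAvg_exp_le h0 h1 hθ hL u hu S
    _ ≤ Real.exp m * Real.exp (θ * bernoulliAvg p w (bernoulliAvg p u f) S +
        p * w.card * ((θ * M) ^ 2 / (2 * (1 - θ * M / 3)))) := by
        rw [bernoulliAvg_const_mul]
        gcongr
        refine bernoulliAvg_exp_le h0 h1 hθ (by linarith) w (fun e he S => ?_) S
        rw [bernoulliAvg_insert_sub_erase p (Finset.disjoint_right.1 huw he)]
        exact hw e he S
    _ ≤ _ := by
        rw [← Real.exp_add]
        refine Real.exp_le_exp.2 ?_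
        have h2 : p * w.card * ((θ * M) ^ 2 / (2 * (1 - θ * M / 3))) ≤
            p * w.card * ((θ * M) ^ 2 / (2 * (1 - θ * L / 3))) := by gcongr
        have h3 : m + p * w.card * ((θ * M) ^ 2 / (2 * (1 - θ * L / 3))) =
            θ ^ 2 * (p * (u.card * L ^ 2 + w.card * M ^ 2)) / (2 * (1 - θ * L / 3)) := by
          simp only [m]; ring
        have h4 : θ ^ 2 * (p * (u.card * L ^ 2 + w.card * M ^ 2)) / (2 * (1 - θ * L / 3)) ≤
            θ ^ 2 * V / (2 * (1 - θ * L / 3)) := by gcongr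
        linarith

end Bernstein

/-! ### Bernstein's inequality for binomial random graphs -/

section RandomGraph

variable {V : Type*} [Fintype V] [DecidableEq V]

instance simpleGraph_measurableSingletonClass {V : Type*} [Countable V] :
    MeasurableSingletonClass (SimpleGraph V) where
  measurableSet_singleton G := by
    have h : ({G} : Set (SimpleGraph V)) = SimpleGraph.edgeSet ⁻¹' {G.edgeSet} := by
      ext H
      simp
    rw [h]
    exact SimpleGraph.measurable_edgeSet (measurableSet_singleton _)

variable (V) in
/-- The set of all possible edges of a simple graph on `V`. -/
def allEdges : Finset (Sym2 V) := Finset.univ.filter fun e => ¬ e.IsDiag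

lemma mem_allEdges {e : Sym2 V} : e ∈ allEdges V ↔ ¬ e.IsDiag := by simp [allEdges]

lemma card_allEdges : (allEdges V).card = (Fintype.card V).choose 2 := by
  rw [← Sym2.card_subtype_not_diag, allEdges, Fintype.card_subtype]

/-- Expectations over the binomial random graph are Bernoulli averages over the edges. -/
lemma integral_binomialRandom (p : unitInterval) (F : SimpleGraph V → ℝ) :
    ∫ G, F G ∂(SimpleGraph.binomialRandom V p) =
      bernoulliAvg p (allEdges V) (fun S => F (SimpleGraph.fromEdgeSet S)) ∅ := by
  classical
  rw [integral_fintype Integrable.of_finite, bernoulliAvg]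
  have hmem : ∀ (G : SimpleGraph V) (e : Sym2 V), e ∈ G.edgeFinset ↔ e ∈ G.edgeSet :=
    fun G e => SimpleGraph.mem_edgeFinset
  have hS : ∀ S ∈ (allEdges V).powerset,
      (SimpleGraph.fromEdgeSet (S : Set (Sym2 V))).edgeSet = S := by
    intro S hS
    rw [SimpleGraph.edgeSet_fromEdgeSet, sdiff_eq_left, Set.disjoint_left]
    intro e he
    simpa using mem_allEdges.1 (Finset.mem_powerset.1 hS he)
  refine Finset.sum_nbij' (fun G => G.edgeFinset)
    (fun S => SimpleGraph.fromEdgeSet (S : Set (Sym2 V))) ?_ ?_ ?_ ?_ ?_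
  · intro G _
    refine Finset.mem_powerset.2 fun e he => mem_allEdges.2 ?_
    exact G.not_isDiag_of_mem_edgeSet (SimpleGraph.mem_edgeFinset.1 he)
  · intro S _
    simp
  · intro G _
    simp
  · intro S h
    ext e
    refine (hmem _ e).trans ?_
    rw [hS S h]
    simp
  · intro G _
    have hsub : G.edgeFinset ⊆ allEdges V := fun e he => mem_allEdges.2
      (G.not_isDiag_of_mem_edgeSet (SimpleGraph.mem_edgeFinset.1 he))
    rw [measureReal_def, SimpleGraph.binomialRandom_singleton, Finset.card_sdiff_of_subset hsub,
      card_allEdges, ← SimpleGraph.coe_edgeFinset, Set.ncard_coe_finset]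
    simp

/-- Bernstein's inequality for a function of the edges of a binomial random graph. -/
lemma measureReal_le_sub_integral (p : unitInterval) {F : SimpleGraph V → ℝ} {L W x : ℝ}
    (hL : 0 ≤ L) (hW : 0 < W) (hx : 0 ≤ x)
    (hF : ∀ θ : ℝ, 0 ≤ θ → θ * L < 3 →
      bernoulliAvg p (allEdges V) (fun S => Real.exp (θ * F (SimpleGraph.fromEdgeSet S))) ∅ ≤
        Real.exp (θ * bernoulliAvg p (allEdges V) (fun S => F (SimpleGraph.fromEdgeSet S)) ∅ +
          θ ^ 2 * W / (2 * (1 - θ * L / 3)))) :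
    (SimpleGraph.binomialRandom V p).real
        {G | x ≤ F G - ∫ H, F H ∂(SimpleGraph.binomialRandom V p)} ≤
      Real.exp (-(x ^ 2 / (2 * (W + L * x / 3)))) := by
  set μ := SimpleGraph.binomialRandom V p
  set E := ∫ H, F H ∂μ with hE
  set D := W + L * x / 3 with hD
  have hDpos : 0 < D := by positivity
  -- This choice gives `1 - θ L / 3 = W / D`, so the exponent `-θ x + θ² D / 2` becomes `-x² / (2
  -- D)`.
  set θ := x / D with hθ
  have hθ0 : 0 ≤ θ := by positivity
  have h1 : 1 - θ * L / 3 = W / D := by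
    rw [hθ, eq_div_iff hDpos.ne']
    field_simp
    rw [hD]; ring
  have hθL : θ * L < 3 := by
    have : 0 < W / D := by positivity
    linarith
  have hmgf := hF θ hθ0 hθL
  rw [← integral_binomialRandom p F, ← integral_binomialRandom p (fun G => Real.exp (θ * F G))]
    at hmgf
  have h2 := ProbabilityTheory.measure_ge_le_exp_mul_mgf (μ := μ) (X := fun G => F G) (x + E) hθ0
    Integrable.of_finite
  have h3 : {G | x ≤ F G - E} = {G | x + E ≤ F G} := by
    ext G; simp [le_sub_iff_add_le]
  rw [h3]
  refine h2.trans ?_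
  calc _ ≤ Real.exp (-θ * (x + E)) * Real.exp (θ * E + θ ^ 2 * W / (2 * (1 - θ * L / 3))) := by
        gcongr
        exact hmgf
    _ = _ := by
        rw [← Real.exp_add, h1]
        congr 1
        rw [hθ]
        field_simp
        ring

/-- The two-sided form of Bernstein's inequality, with differences bounded by `L` on `u` and, after
averaging over `u`, by `M` on the other edges. -/
lemma measureReal_le_abs_sub_integral (p : unitInterval) {F : SimpleGraph V → ℝ} {L M W x : ℝ}
    (hL : 0 ≤ L) (hML : M ≤ L) (hW : 0 < W) (hx : 0 ≤ x) {u w : Finset (Sym2 V)}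
    (huw : Disjoint u w) (hunion : w ∪ u = allEdges V)
    (hu : ∀ e ∈ u, ∀ S : Finset (Sym2 V), |F (SimpleGraph.fromEdgeSet (insert e S : Finset _)) -
      F (SimpleGraph.fromEdgeSet (S.erase e : Finset _))| ≤ L)
    (hw : ∀ e ∈ w, ∀ S, |bernoulliAvg p u (fun S =>
      F (SimpleGraph.fromEdgeSet (insert e S : Finset _)) -
        F (SimpleGraph.fromEdgeSet (S.erase e : Finset _))) S| ≤ M)
    (hV : (p : ℝ) * (u.card * L ^ 2 + w.card * M ^ 2) ≤ W) :
    (SimpleGraph.binomialRandom V p).real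
        {G | x ≤ |F G - ∫ H, F H ∂(SimpleGraph.binomialRandom V p)|} ≤
      2 * Real.exp (-(x ^ 2 / (2 * (W + L * x / 3)))) := by
  have h0 : (0 : ℝ) ≤ p := p.2.1
  have h1 : (p : ℝ) ≤ 1 := p.2.2
  have hpos := measureReal_le_sub_integral p (F := F) hL hW hx fun θ hθ hθL => by
    rw [← hunion]
    exact bernoulliAvg_exp_le_of_disjoint h0 h1 hθ hθL hML huw hu hw hV ∅
  have hneg := measureReal_le_sub_integral p (F := fun G => - F G) hL hW hx fun θ hθ hθL => by
    rw [← hunion]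
    refine bernoulliAvg_exp_le_of_disjoint h0 h1 hθ hθL hML huw (fun e he S => ?_)
      (fun e he S => ?_) hV ∅
    · rw [neg_sub_neg, abs_sub_comm]
      exact hu e he S
    · refine le_of_eq_of_le ?_ (hw e he S)
      rw [← abs_neg, ← bernoulliAvg_neg]
      congr 2
      ext S
      ring
  rw [integral_neg] at hneg
  refine (measureReal_mono (s₂ := {G | x ≤ F G - ∫ H, F H ∂(SimpleGraph.binomialRandom V p)} ∪
    {G | x ≤ -F G - -∫ H, F H ∂(SimpleGraph.binomialRandom V p)}) ?_).trans
    ((measureReal_union_le _ _).trans (by linarith))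
  intro G hG
  rcases le_abs.1 (show x ≤ |_| from hG) with h | h
  · exact Or.inl h
  · refine Or.inr ?_
    show x ≤ _
    linarith

/-- A prescribed set `T` of edges is present with probability `p ^ |T|`. -/
lemma integral_subset_edgeSet (p : unitInterval) {T : Finset (Sym2 V)} (hT : T ⊆ allEdges V)
    [∀ G : SimpleGraph V, Decidable ((T : Set (Sym2 V)) ⊆ G.edgeSet)] :
    ∫ G : SimpleGraph V, (if (T : Set (Sym2 V)) ⊆ G.edgeSet then (1 : ℝ) else 0)
      ∂(SimpleGraph.binomialRandom V p) = (p : ℝ) ^ T.card := by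
  rw [integral_binomialRandom, ← bernoulliAvg_superset (p : ℝ) hT ∅]
  congr 1
  ext S
  have : ((T : Set (Sym2 V)) ⊆ (SimpleGraph.fromEdgeSet (S : Set (Sym2 V))).edgeSet) ↔ T ⊆ S := by
    rw [SimpleGraph.edgeSet_fromEdgeSet]
    constructor
    · exact fun h e he => (h he).1
    · exact fun h e he => ⟨h he, by simpa using mem_allEdges.1 (hT he)⟩
  simp only [this]

end RandomGraph

/-! ### Peeling of graphs and the effect of one edge -/

section Peel

variable {V : Type*}

/-- The vertices left after `t` rounds in which all vertices with at most one neighbour among the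
vertices still present are removed. -/
def peel (G : SimpleGraph V) : ℕ → Set V
  | 0 => Set.univ
  | t + 1 => {v | v ∈ peel G t ∧
      ∃ x ∈ peel G t, ∃ y ∈ peel G t, x ≠ y ∧ G.Adj v x ∧ G.Adj v y}

/-- The vertices left after `t` rounds of peeling that still have a neighbour. -/
def peelSupport (G : SimpleGraph V) (t : ℕ) : Set V :=
  {v | v ∈ peel G t ∧ ∃ x ∈ peel G t, G.Adj v x}

lemma peel_antitone (G : SimpleGraph V) : Antitone (peel G) :=
  antitone_nat_of_succ_le fun _ _ hv => hv.1

lemma peel_mono {H G : SimpleGraph V} (h : H ≤ G) (t : ℕ) : peel H t ⊆ peel G t := by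
  induction t with
  | zero => exact fun _ _ => trivial
  | succ t ih =>
    rintro v ⟨hv, x, hx, y, hy, hxy, h1, h2⟩
    exact ⟨ih hv, x, ih hx, y, ih hy, hxy, h h1, h h2⟩

lemma peelSupport_mono {H G : SimpleGraph V} (h : H ≤ G) (t : ℕ) :
    peelSupport H t ⊆ peelSupport G t := by
  rintro v ⟨hv, x, hx, h1⟩
  exact ⟨peel_mono h t hv, x, peel_mono h t hx, h h1⟩

/-- A removed vertex has at most one neighbour that outlives it. -/
lemma exists_peel_successor (H : SimpleGraph V) :
    ∃ s : V → V, ∀ (t : ℕ) (x y : V), y ∉ peel H t → x ∈ peel H t → H.Adj y x → x = s y := by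
  classical
  have huniq : ∀ y x x' : V, ∀ t t' : ℕ, y ∉ peel H t → y ∉ peel H t' → x ∈ peel H t →
      x' ∈ peel H t' → H.Adj y x → H.Adj y x' → x = x' := by
    intro y x x' t t' hy hy' hx hx' h h'
    have hex : ∃ m, y ∉ peel H m := ⟨t, hy⟩
    -- `y` is removed in round `m + 1`, so at most one of its neighbours lies in `peel H m`, a set
    -- that contains every neighbour outliving `y`.
    obtain ⟨m, hm⟩ : ∃ m, Nat.find hex = m + 1 :=
      Nat.exists_eq_succ_of_ne_zero fun h0 => (h0 ▸ Nat.find_spec hex) trivial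
    have hmem : y ∈ peel H m := not_not.1 (Nat.find_min hex (by omega))
    have hnot : y ∉ peel H (m + 1) := hm ▸ Nat.find_spec hex
    have hle : m ≤ t := by have := Nat.find_min' hex hy; omega
    have hle' : m ≤ t' := by have := Nat.find_min' hex hy'; omega
    by_contra hne
    exact hnot ⟨hmem, x, peel_antitone H hle hx, x', peel_antitone H hle' hx', hne, h, h'⟩
  refine ⟨fun y => if h : ∃ x t, y ∉ peel H t ∧ x ∈ peel H t ∧ H.Adj y x then h.choose else y,
    fun t x y hy hx hadj => ?_⟩
  have hex : ∃ x t, y ∉ peel H t ∧ x ∈ peel H t ∧ H.Adj y x := ⟨x, t, hy, hx, hadj⟩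
  obtain ⟨t', h1, h2, h3⟩ := hex.choose_spec
  simp only [dif_pos hex]
  exact huniq y x _ t t' hy h1 hx h2 hadj h3

section AddEdge

variable {H G : SimpleGraph V} {u v : V} {s : V → V}

/-- A neighbour that is new for `x` comes through the added edge or is a rescued vertex `y`; in the
latter case `x` outlives `y` in `H`, so it is the successor of `y`. -/
lemma eq_successor_of_new_neighbour
    (hG : ∀ a b, G.Adj a b → H.Adj a b ∨ s(a, b) = s(u, v))
    (hs : ∀ (t : ℕ) (x y : V), y ∉ peel H t → x ∈ peel H t → H.Adj y x → x = s y)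
    {t : ℕ} {x y : V} (hx : x ∈ peel H t) (hy : y ∈ peel G t) (hxy : G.Adj x y)
    (hnew : ¬ (y ∈ peel H t ∧ H.Adj x y)) :
    x = u ∨ x = v ∨ (y ∈ peel G t \ peel H t ∧ x = s y) := by
  rcases hG x y hxy with h | h
  · have hy' : y ∉ peel H t := fun hy' => hnew ⟨hy', h⟩
    exact Or.inr (Or.inr ⟨⟨hy, hy'⟩, hs t x y hy' hx h.symm⟩)
  · rcases Sym2.eq_iff.1 h with h | h
    · exact Or.inl h.1
    · exact Or.inr (Or.inl h.1)

/-- The vertices that survive `t` rounds of peeling only because of the edge `uv`. -/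
lemma exists_iterate_of_mem_peel_diff
    (hG : ∀ a b, G.Adj a b → H.Adj a b ∨ s(a, b) = s(u, v))
    (hs : ∀ (t : ℕ) (x y : V), y ∉ peel H t → x ∈ peel H t → H.Adj y x → x = s y)
    {t : ℕ} {x : V} (hx : x ∈ peel G t \ peel H t) :
    ∃ i < t, x = s^[i] u ∨ x = s^[i] v := by
  induction t generalizing x with
  | zero => exact absurd trivial hx.2
  | succ t ih =>
    obtain ⟨⟨hxG, y, hy, z, hz, hyz, hxy, hxz⟩, hxH⟩ := hx
    by_cases hxt : x ∈ peel H t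
    -- In `H` the vertex `x` is removed just now, so one of its two neighbours in `G` is new; a
    -- chain grows by one step.
    · obtain ⟨w, hw, hxw, hnew⟩ : ∃ w ∈ peel G t, G.Adj x w ∧ ¬ (w ∈ peel H t ∧ H.Adj x w) := by
        by_contra! hcon
        have h1 := hcon y hy hxy
        have h2 := hcon z hz hxz
        exact hxH ⟨hxt, y, h1.1, z, h2.1, hyz, h1.2, h2.2⟩
      rcases eq_successor_of_new_neighbour hG hs hxt hw hxw hnew with h | h | ⟨hw', h⟩
      · exact ⟨0, t.succ_pos, Or.inl h⟩
      · exact ⟨0, t.succ_pos, Or.inr h⟩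
      · obtain ⟨i, hi, h'⟩ := ih hw'
        refine ⟨i + 1, by omega, ?_⟩
        rw [Function.iterate_succ_apply', Function.iterate_succ_apply', h]
        exact h'.imp (congrArg s) (congrArg s)
    · obtain ⟨i, hi, h⟩ := ih ⟨hxG, hxt⟩
      exact ⟨i, by omega, h⟩

/-- The final demand for one neighbour lets each chain grow once more, hence `t + 1` vertices per
chain instead of `t`. -/
lemma exists_iterate_of_mem_peelSupport_diff
    (hG : ∀ a b, G.Adj a b → H.Adj a b ∨ s(a, b) = s(u, v))
    (hs : ∀ (t : ℕ) (x y : V), y ∉ peel H t → x ∈ peel H t → H.Adj y x → x = s y)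
    {t : ℕ} {x : V} (hx : x ∈ peelSupport G t \ peelSupport H t) :
    x = u ∨ x = v ∨ x ∈ peel G t \ peel H t ∨ ∃ y ∈ peel G t \ peel H t, x = s y := by
  obtain ⟨⟨hxG, y, hy, hxy⟩, hxH⟩ := hx
  by_cases hxt : x ∈ peel H t
  · rcases eq_successor_of_new_neighbour hG hs hxt hy hxy
      (fun h => hxH ⟨hxt, y, h.1, h.2⟩) with h | h | ⟨hw', h⟩
    · exact Or.inl h
    · exact Or.inr (Or.inl h)
    · exact Or.inr (Or.inr (Or.inr ⟨y, hw', h⟩))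
  · exact Or.inr (Or.inr (Or.inl ⟨hxG, hxt⟩))

/-- Adding an edge increases the number of vertices left by at most `2 (t + 1)`. -/
lemma ncard_peelSupport_le_add [Finite V]
    (hG : ∀ a b, G.Adj a b → H.Adj a b ∨ s(a, b) = s(u, v)) (t : ℕ) :
    (peelSupport G t).ncard ≤ (peelSupport H t).ncard + 2 * (t + 1) := by
  classical
  obtain ⟨s, hs⟩ := exists_peel_successor H
  set C : Finset V := (Finset.range (t + 1)).image (fun i => s^[i] u) ∪
    (Finset.range (t + 1)).image (fun i => s^[i] v) with hC
  have hCcard : C.card ≤ 2 * (t + 1) := by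
    refine (Finset.card_union_le _ _).trans ?_
    have h1 := Finset.card_image_le (s := Finset.range (t + 1)) (f := fun i => s^[i] u)
    have h2 := Finset.card_image_le (s := Finset.range (t + 1)) (f := fun i => s^[i] v)
    rw [Finset.card_range] at h1 h2
    omega
  have hmem : ∀ x, (∃ i < t + 1, x = s^[i] u ∨ x = s^[i] v) → x ∈ C := by
    rintro x ⟨i, hi, rfl | rfl⟩
    · exact Finset.mem_union_left _ (Finset.mem_image.2 ⟨i, Finset.mem_range.2 hi, rfl⟩)
    · exact Finset.mem_union_right _ (Finset.mem_image.2 ⟨i, Finset.mem_range.2 hi, rfl⟩)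
  have hsub : peelSupport G t ⊆ peelSupport H t ∪ C := by
    intro x hx
    by_cases hxH : x ∈ peelSupport H t
    · exact Or.inl hxH
    refine Or.inr (hmem x ?_)
    rcases exists_iterate_of_mem_peelSupport_diff hG hs ⟨hx, hxH⟩ with h | h | h | ⟨y, hy, h⟩
    · exact ⟨0, t.succ_pos, Or.inl h⟩
    · exact ⟨0, t.succ_pos, Or.inr h⟩
    · obtain ⟨i, hi, h'⟩ := exists_iterate_of_mem_peel_diff hG hs h
      exact ⟨i, by omega, h'⟩
    · obtain ⟨i, hi, h'⟩ := exists_iterate_of_mem_peel_diff hG hs hy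
      refine ⟨i + 1, by omega, ?_⟩
      rw [Function.iterate_succ_apply', Function.iterate_succ_apply', h]
      exact h'.imp (congrArg s) (congrArg s)
  calc (peelSupport G t).ncard ≤ (peelSupport H t ∪ C).ncard := Set.ncard_le_ncard hsub
    _ ≤ (peelSupport H t).ncard + (C : Set V).ncard := Set.ncard_union_le _ _
    _ ≤ _ := by rw [Set.ncard_coe_finset]; omega

/-- For one round of peeling the bound on the effect of an edge `uv` improves unless `u` is a
leaf. -/
lemma ncard_peelSupport_one_le_add_three [Finite V]
    (hG : ∀ a b, G.Adj a b → H.Adj a b ∨ s(a, b) = s(u, v))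
    (hu : (H.neighborSet u).ncard ≠ 1) :
    (peelSupport G 1).ncard ≤ (peelSupport H 1).ncard + 3 := by
  classical
  obtain ⟨s, hs⟩ := exists_peel_successor H
  -- After one round only `u` and `v` can be rescued, and `u` only if `uv` supplies its second
  -- neighbour, that is, if `u` is a leaf of `H`.
  have hdiff : ∀ y ∈ peel G 1 \ peel H 1, y = v := by
    intro y hy
    obtain ⟨i, hi, h⟩ := exists_iterate_of_mem_peel_diff hG hs hy
    obtain rfl : i = 0 := by omega
    rcases h with h | h
    · obtain ⟨⟨_, a, -, b, -, hab, ha, hb⟩, hyH⟩ := hy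
      have h : y = u := h
      subst h
      by_contra hyv
      have hone : ∃ z, H.Adj y z := by
        rcases hG y a ha with h1 | h1
        · exact ⟨a, h1⟩
        rcases hG y b hb with h2 | h2
        · exact ⟨b, h2⟩
        rw [← h2] at h1
        exact absurd (Sym2.congr_right.1 h1) hab
      obtain ⟨z, hz⟩ := hone
      refine hu (Set.ncard_eq_one.2 ⟨z, Set.eq_singleton_iff_unique_mem.2 ⟨hz, fun z' hz' => ?_⟩⟩)
      by_contra hne
      exact hyH ⟨trivial, z', trivial, z, trivial, hne, hz', hz⟩
    · exact h
  have hsub : peelSupport G 1 ⊆ peelSupport H 1 ∪ ({u, v, s v} : Finset V) := by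
    intro x hx
    by_cases hxH : x ∈ peelSupport H 1
    · exact Or.inl hxH
    refine Or.inr ?_
    simp only [Finset.coe_insert, Finset.coe_singleton, Set.mem_insert_iff, Set.mem_singleton_iff]
    rcases exists_iterate_of_mem_peelSupport_diff hG hs ⟨hx, hxH⟩ with h | h | h | ⟨y, hy, h⟩
    · exact Or.inl h
    · exact Or.inr (Or.inl h)
    · exact Or.inr (Or.inl (hdiff x h))
    · exact Or.inr (Or.inr (by rw [h, hdiff y hy]))
  calc (peelSupport G 1).ncard ≤ (peelSupport H 1 ∪ ({u, v, s v} : Finset V)).ncard :=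
        Set.ncard_le_ncard hsub
    _ ≤ (peelSupport H 1).ncard + (({u, v, s v} : Finset V) : Set V).ncard :=
        Set.ncard_union_le _ _
    _ ≤ _ := by
        rw [Set.ncard_coe_finset]
        have := Finset.card_le_three (a := u) (b := v) (c := s v)
        omega

end AddEdge

/-- Deleting a finite set `T` of edges decreases the number of vertices left by at most
`2 (t + 1) |T|`. -/
lemma ncard_peelSupport_le_add_card [Finite V] (G : SimpleGraph V) (T : Finset (Sym2 V)) (t : ℕ) :
    (peelSupport G t).ncard ≤
      (peelSupport (G.deleteEdges T) t).ncard + 2 * (t + 1) * T.card := by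
  classical
  induction T using Finset.induction_on with
  | empty => simp
  | insert e T he ih =>
    induction e using Sym2.ind with
    | h u v =>
      have hG : ∀ a b, (G.deleteEdges (T : Set (Sym2 V))).Adj a b →
          (G.deleteEdges (insert s(u, v) T : Finset (Sym2 V))).Adj a b ∨ s(a, b) = s(u, v) := by
        intro a b hab
        simp only [SimpleGraph.deleteEdges_adj, Finset.coe_insert, Set.mem_insert_iff] at hab ⊢
        tauto
      have h := ncard_peelSupport_le_add hG t
      rw [Finset.card_insert_of_notMem he]
      linarith

end Peel

/-! ### Comparison of pruning with peeling -/

section Pruning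

variable {V : Type*} [DecidableEq V]

/-- After `t` pruning phases a clique complex is the clique complex induced on the vertices left. -/
lemma mem_afterPhases_cliqueComplex (G : SimpleGraph V) (t : ℕ) (τ : Finset V) :
    τ ∈ afterPhases t (cliqueComplex G) ↔
      τ.Nonempty ∧ G.IsClique (τ : Set V) ∧ ∀ v ∈ τ, {v} ∈ afterPhases t (cliqueComplex G) := by
  induction t generalizing τ with
  | zero =>
    have h : ∀ σ : Finset V, σ ∈ afterPhases 0 (cliqueComplex G) ↔
        σ.Nonempty ∧ G.IsClique (σ : Set V) := fun σ => Iff.rfl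
    simp only [h]
    simp
  | succ t ih =>
    have h : ∀ σ : Finset V, σ ∈ afterPhases (t + 1) (cliqueComplex G) ↔
        σ ∈ afterPhases t (cliqueComplex G) ∧
          ∀ v ∈ σ, ¬ IsDominatedVertex (afterPhases t (cliqueComplex G)) v := by
      intro σ
      unfold afterPhases
      rw [Function.iterate_succ_apply']
      exact Iff.rfl
    simp only [h]
    rw [ih]
    simp only [Finset.mem_singleton, forall_eq]
    constructor
    · rintro ⟨⟨h1, h2, h3⟩, h4⟩
      exact ⟨h1, h2, fun v hv => ⟨h3 v hv, h4 v hv⟩⟩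
    · rintro ⟨h1, h2, h3⟩
      exact ⟨⟨h1, h2, fun v hv => (h3 v hv).1⟩, fun v hv => (h3 v hv).2⟩

lemma singleton_mem_afterPhases_succ (K : PreAbstractSimplicialComplex V) (t : ℕ) (v : V) :
    {v} ∈ afterPhases (t + 1) K ↔
      {v} ∈ afterPhases t K ∧ ¬ IsDominatedVertex (afterPhases t K) v := by
  unfold afterPhases
  rw [Function.iterate_succ_apply']
  change ({v} ∈ prune^[t] K ∧ ∀ w ∈ ({v} : Finset V), ¬ IsDominatedVertex (prune^[t] K) w) ↔ _
  simp

lemma pair_mem_afterPhases_cliqueComplex (G : SimpleGraph V) (t : ℕ) {v w : V} (h : w ≠ v) :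
    {v, w} ∈ afterPhases t (cliqueComplex G) ↔ G.Adj v w ∧
      {v} ∈ afterPhases t (cliqueComplex G) ∧ {w} ∈ afterPhases t (cliqueComplex G) := by
  rw [mem_afterPhases_cliqueComplex]
  simp [SimpleGraph.isClique_iff, Set.pairwise_insert, G.adj_comm w v, h.symm]

variable {G : SimpleGraph V} {t : ℕ}

/-- A vertex with exactly one neighbour left is dominated by it. -/
lemma isDominatedVertex_of_unique_neighbour {v a : V} (hav : a ≠ v)
    (ha : {v, a} ∈ afterPhases t (cliqueComplex G))
    (huniq : ∀ x, x ≠ v → {v, x} ∈ afterPhases t (cliqueComplex G) → x = a) :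
    IsDominatedVertex (afterPhases t (cliqueComplex G)) v := by
  set K := afterPhases t (cliqueComplex G) with hK
  have hlow : ∀ {σ τ : Finset V}, τ ∈ K → σ ⊆ τ → σ.Nonempty → σ ∈ K :=
    fun hτ hs hne => (K.isRelLowerSet_faces hτ).2 hs hne
  -- The link is the single point `a`, a cone over the empty base.
  let L : PreAbstractSimplicialComplex V := ⟨∅, fun _ h => h.elim⟩
  have hL : ∀ σ, σ ∉ L := fun _ h => h
  refine ⟨a, hlow ha (by simp) (by simp), by simpa using hav, L, fun σ h => (hL σ h).elim,
    hL _, SetLike.ext fun τ => ?_⟩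
  change (τ ∈ K ∧ τ ∪ {v} ∈ K ∧ Disjoint τ {v}) ↔ (τ = {a} ∨ τ ∈ L ∨ ∃ σ ∈ L, τ = insert a σ)
  constructor
  · rintro ⟨h1, h2, h3⟩
    left
    refine Finset.eq_singleton_iff_nonempty_unique_mem.2
      ⟨(K.isRelLowerSet_faces h1).1, fun x hx => ?_⟩
    refine huniq x ?_ (hlow h2 ?_ (by simp))
    · rintro rfl
      exact Finset.disjoint_left.1 h3 hx (by simp)
    · intro y hy
      simp only [Finset.mem_insert, Finset.mem_singleton] at hy
      rcases hy with rfl | rfl <;> simp [hx]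
  · rintro (rfl | h | ⟨σ, h, -⟩)
    · refine ⟨hlow ha (by simp) (by simp), ?_, by simpa using hav⟩
      rw [Finset.union_comm]
      exact ha
    · exact (hL _ h).elim
    · exact (hL _ h).elim

/-- A dominated vertex with two neighbours left lies in a triangle. -/
lemma exists_triangle_of_isDominatedVertex {v x y : V}
    (hdom : IsDominatedVertex (afterPhases t (cliqueComplex G)) v) (hxy : x ≠ y)
    (hxv : x ≠ v) (hyv : y ≠ v) (hx : {v, x} ∈ afterPhases t (cliqueComplex G))
    (hy : {v, y} ∈ afterPhases t (cliqueComplex G)) :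
    ∃ b c, G.Adj v b ∧ G.Adj b c ∧ G.Adj c v := by
  set K := afterPhases t (cliqueComplex G) with hK
  obtain ⟨a, -, hav, L, -, -, hlink⟩ := hdom
  have hmem : ∀ τ, (τ ∈ K ∧ τ ∪ {v} ∈ K ∧ Disjoint τ {v}) ↔
      (τ = {a} ∨ τ ∈ L ∨ ∃ σ ∈ L, τ = insert a σ) := fun τ => SetLike.ext_iff.1 hlink τ
  have hav' : a ≠ v := by simpa using hav
  have hva : {v, a} ∈ K := by
    have := ((hmem {a}).2 (Or.inl rfl)).2.1
    rwa [Finset.union_comm] at this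
  -- A neighbour `z ≠ a` of `v` lies in the link, hence in the base `L`; the cone then contains the
  -- edge `az`, and `v`, `a`, `z` form a triangle.
  obtain ⟨z, hza, hzv, hz⟩ : ∃ z, z ≠ a ∧ z ≠ v ∧ {v, z} ∈ K := by
    by_cases h : x = a
    · exact ⟨y, fun h' => hxy (h.trans h'.symm), hyv, hy⟩
    · exact ⟨x, h, hxv, hx⟩
  have hzlink : {z} ∈ K ∧ {z} ∪ {v} ∈ K ∧ Disjoint ({z} : Finset V) {v} := by
    refine ⟨(K.isRelLowerSet_faces hz).2 (by simp) (by simp), ?_, by simpa using hzv⟩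
    rw [Finset.union_comm]
    exact hz
  have hzL : {z} ∈ L := by
    rcases (hmem {z}).1 hzlink with h | h | ⟨σ, -, h⟩
    · exact absurd (Finset.singleton_injective h) hza
    · exact h
    · have : a ∈ ({z} : Finset V) := h ▸ Finset.mem_insert_self a σ
      exact absurd (Finset.mem_singleton.1 this).symm hza
  have haz : {a, z} ∈ K := ((hmem {a, z}).2 (Or.inr (Or.inr ⟨{z}, hzL, rfl⟩))).1
  refine ⟨a, z, ?_, ?_, ?_⟩
  · exact ((pair_mem_afterPhases_cliqueComplex G t hav').1 hva).1
  · exact ((pair_mem_afterPhases_cliqueComplex G t hza).1 haz).1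
  · exact ((pair_mem_afterPhases_cliqueComplex G t hzv).1 hz).1.symm

/-- A vertex that keeps an edge through the next phase is not dominated, so it has two neighbours,
and these are themselves non-isolated. Isolated vertices must be excluded: their link is empty, so
pruning never removes them. -/
lemma nonIsolated_afterPhases_subset_peel (G : SimpleGraph V) (t : ℕ) :
    nonIsolated (afterPhases t (cliqueComplex G)) ⊆ peel G t := by
  induction t with
  | zero => exact fun _ _ => trivial
  | succ t ih =>
    rintro v ⟨w, hwv, hvw⟩
    obtain ⟨hadj, hv, hw⟩ := (pair_mem_afterPhases_cliqueComplex G (t + 1) hwv).1 hvw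
    rw [singleton_mem_afterPhases_succ] at hv hw
    have hvw' := (pair_mem_afterPhases_cliqueComplex G t hwv).2 ⟨hadj, hv.1, hw.1⟩
    obtain ⟨x, hxv, hx, hxw⟩ :
        ∃ x, x ≠ v ∧ {v, x} ∈ afterPhases t (cliqueComplex G) ∧ x ≠ w := by
      by_contra! hcon
      exact hv.2 (isDominatedVertex_of_unique_neighbour hwv hvw' hcon)
    refine ⟨ih ⟨w, hwv, hvw'⟩, w, ih ⟨v, hwv.symm, ?_⟩, x, ih ⟨v, hxv.symm, ?_⟩, hxw.symm, hadj,
      ((pair_mem_afterPhases_cliqueComplex G t hxv).1 hx).1⟩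
    · rwa [Finset.pair_comm]
    · rwa [Finset.pair_comm]

lemma nonIsolated_afterPhases_subset_peelSupport (G : SimpleGraph V) (t : ℕ) :
    nonIsolated (afterPhases t (cliqueComplex G)) ⊆ peelSupport G t := by
  rintro v ⟨w, hwv, hvw⟩
  refine ⟨nonIsolated_afterPhases_subset_peel G t ⟨w, hwv, hvw⟩, w,
    nonIsolated_afterPhases_subset_peel G t ⟨v, hwv.symm, by rwa [Finset.pair_comm]⟩,
    ((pair_mem_afterPhases_cliqueComplex G t hwv).1 hvw).1⟩

/-- Peeling a subgraph without edges at the vertices of triangles leaves no more than pruning. -/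
lemma peelSupport_subset_nonIsolated_afterPhases {H : SimpleGraph V} (hHG : H ≤ G)
    (hH : ∀ v b c x, G.Adj v b → G.Adj b c → G.Adj c v → ¬ H.Adj v x) (t : ℕ) :
    peelSupport H t ⊆ nonIsolated (afterPhases t (cliqueComplex G)) := by
  have key : ∀ v ∈ peel H t, {v} ∈ afterPhases t (cliqueComplex G) := by
    induction t with
    | zero => exact fun v _ => ⟨by simp, by simp⟩
    | succ t ih =>
      rintro v ⟨hv, x, hx, y, hy, hxy, hvx, hvy⟩
      rw [singleton_mem_afterPhases_succ]
      refine ⟨ih v hv, fun hdom => ?_⟩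
      have hx' := (pair_mem_afterPhases_cliqueComplex G t hvx.ne').2 ⟨hHG hvx, ih v hv, ih x hx⟩
      have hy' := (pair_mem_afterPhases_cliqueComplex G t hvy.ne').2 ⟨hHG hvy, ih v hv, ih y hy⟩
      obtain ⟨b, c, h1, h2, h3⟩ :=
        exists_triangle_of_isDominatedVertex hdom hxy hvx.ne' hvy.ne' hx' hy'
      exact hH v b c x h1 h2 h3 hvx
  rintro v ⟨hv, x, hx, hvx⟩
  exact ⟨x, hvx.ne', (pair_mem_afterPhases_cliqueComplex G t hvx.ne').2
    ⟨hHG hvx, key v hv, key x hx⟩⟩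

lemma survivors_zero (G : SimpleGraph V) : survivors 0 G = ((peelSupport G 0).ncard : ℝ) := by
  unfold survivors
  congr 2
  refine (nonIsolated_afterPhases_subset_peelSupport G 0).antisymm ?_
  rintro v ⟨-, x, -, hvx⟩
  refine ⟨x, hvx.ne', (pair_mem_afterPhases_cliqueComplex G 0 hvx.ne').2 ⟨hvx, ?_, ?_⟩⟩ <;>
    exact ⟨by simp, by simp⟩

lemma survivors_le_card [Fintype V] (t : ℕ) (G : SimpleGraph V) :
    survivors t G ≤ Fintype.card V := by
  unfold survivors
  have := Set.ncard_le_card (nonIsolated (afterPhases t (cliqueComplex G)))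
  rw [Nat.card_eq_fintype_card] at this
  exact_mod_cast this

open Classical in
/-- The quadruples `(a, b, c, d)` such that `abc` is a triangle and `d` is a neighbour of `a`. -/
noncomputable def paws [Fintype V] (G : SimpleGraph V) : Finset (V × V × V × V) :=
  Finset.univ.filter fun x =>
    G.Adj x.1 x.2.1 ∧ G.Adj x.2.1 x.2.2.1 ∧ G.Adj x.2.2.1 x.1 ∧ G.Adj x.2.2.2 x.1

/-- Pruning and peeling leave almost the same number of vertices if there are few triangles. -/
lemma abs_survivors_sub_ncard_peelSupport_le [Fintype V] (G : SimpleGraph V) (t : ℕ) :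
    |survivors t G - ((peelSupport G t).ncard : ℝ)| ≤ 2 * (t + 1) * (paws G).card := by
  -- The fourth vertex may equal `b` or `c`, so `T` holds all edges with an endpoint in a triangle,
  -- the triangle's own edges included.
  set T : Finset (Sym2 V) := (paws G).image fun x => s(x.2.2.2, x.1) with hT
  have hcard : T.card ≤ (paws G).card := Finset.card_image_le
  have h1 : (nonIsolated (afterPhases t (cliqueComplex G))).ncard ≤ (peelSupport G t).ncard :=
    Set.ncard_le_ncard (nonIsolated_afterPhases_subset_peelSupport G t)
  have h2 : (peelSupport (G.deleteEdges T) t).ncard ≤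
      (nonIsolated (afterPhases t (cliqueComplex G))).ncard := by
    refine Set.ncard_le_ncard (peelSupport_subset_nonIsolated_afterPhases
      (SimpleGraph.deleteEdges_le _) (fun v b c x hvb hbc hcv hvx => ?_) t)
    rw [SimpleGraph.deleteEdges_adj] at hvx
    refine hvx.2 (Finset.mem_coe.2 (Finset.mem_image.2 ⟨(v, b, c, x), ?_, Sym2.eq_swap⟩))
    simp [paws, hvb, hbc, hcv, hvx.1.symm]
  have h3 := ncard_peelSupport_le_add_card G T t
  have h4 : (peelSupport G t).ncard ≤ (nonIsolated (afterPhases t (cliqueComplex G))).ncard +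
      2 * (t + 1) * (paws G).card :=
    h3.trans (add_le_add h2 (Nat.mul_le_mul_left _ hcard))
  have h1' : survivors t G ≤ ((peelSupport G t).ncard : ℝ) := by
    unfold survivors
    exact_mod_cast h1
  have h4' : ((peelSupport G t).ncard : ℝ) ≤ survivors t G + 2 * (t + 1) * (paws G).card := by
    unfold survivors
    exact_mod_cast h4
  rw [abs_sub_comm, abs_of_nonneg (sub_nonneg.2 h1')]
  linarith

end Pruning

/-! ### Second moment of the number of paws -/

section Paws

variable {V : Type*} [DecidableEq V]

/-- If every vertex of `U ∪ U'` can be moved along an edge of `T ∪ T'` without two-cycles inside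
`U` and inside `U'`, then there are at least as many edges as vertices. -/
lemma card_union_le_of_orientation {U U' : Finset V} {T T' : Finset (Sym2 V)} {f f' : V → V}
    (h : ∀ v ∈ U, f v ∈ U ∧ f (f v) ≠ v ∧ s(v, f v) ∈ T)
    (h' : ∀ v ∈ U', f' v ∈ U' ∧ f' (f' v) ≠ v ∧ s(v, f' v) ∈ T') :
    (U ∪ U').card ≤ (T ∪ T').card := by
  -- `f` takes precedence on `U`. As `f` maps `U` to itself, a vertex outside `U` sent into `U`
  -- never returns, so `g` has no two-cycle and `v ↦ s(v, g v)` is injective.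
  set g : V → V := fun v => if v ∈ U then f v else f' v with hg
  have hU : ∀ v ∈ U, g v = f v := fun v hv => if_pos hv
  have hU' : ∀ v ∉ U, g v = f' v := fun v hv => if_neg hv
  have hgg : ∀ v ∈ U ∪ U', g (g v) ≠ v := by
    intro v hv
    by_cases hvU : v ∈ U
    · rw [hU v hvU, hU _ (h v hvU).1]
      exact (h v hvU).2.1
    · have hvU' : v ∈ U' := (Finset.mem_union.1 hv).resolve_left hvU
      rw [hU' v hvU]
      by_cases hfv : f' v ∈ U
      · rw [hU _ hfv]
        exact fun heq => hvU (heq ▸ (h _ hfv).1)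
      · rw [hU' _ hfv]
        exact (h' v hvU').2.1
  refine Finset.card_le_card_of_injOn (fun v => s(v, g v)) (fun v hv => ?_) ?_
  · have hv : v ∈ U ∪ U' := hv
    by_cases hvU : v ∈ U
    · simp only [hU v hvU]
      exact Finset.mem_coe.2 (Finset.mem_union_left _ (h v hvU).2.2)
    · simp only [hU' v hvU]
      exact Finset.mem_coe.2 (Finset.mem_union_right _
        (h' v ((Finset.mem_union.1 hv).resolve_left hvU)).2.2)
  · intro v hv w _ hvw
    rcases Sym2.eq_iff.1 hvw with h | h
    · exact h.1
    · refine absurd ?_ (hgg v hv)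
      rw [h.2]
      exact h.1.symm

/-- The vertices of a quadruple. -/
def pawVertices (x : V × V × V × V) : Finset V := {x.1, x.2.1, x.2.2.1, x.2.2.2}

/-- The edges of the triangle `abc` with the pendant edge `da`, for a quadruple `(a, b, c, d)`. -/
def pawEdges (x : V × V × V × V) : Finset (Sym2 V) :=
  {s(x.1, x.2.1), s(x.2.1, x.2.2.1), s(x.2.2.1, x.1), s(x.2.2.2, x.1)}

lemma mem_paws_iff [Fintype V] {G : SimpleGraph V} {x : V × V × V × V} :
    x ∈ paws G ↔ (pawEdges x : Set (Sym2 V)) ⊆ G.edgeSet := by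
  simp [paws, pawEdges, Set.insert_subset_iff]

lemma exists_paw_orientation [Fintype V] {x : V × V × V × V} (hx : pawEdges x ⊆ allEdges V) :
    ∃ f : V → V, ∀ v ∈ pawVertices x,
      f v ∈ pawVertices x ∧ f (f v) ≠ v ∧ s(v, f v) ∈ pawEdges x := by
  obtain ⟨a, b, c, d⟩ := x
  have hne : ∀ {y z : V}, s(y, z) ∈ pawEdges (a, b, c, d) → y ≠ z := fun h => by
    simpa using mem_allEdges.1 (hx h)
  have hab : a ≠ b := hne (by simp [pawEdges])
  have hbc : b ≠ c := hne (by simp [pawEdges])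
  have hca : c ≠ a := hne (by simp [pawEdges])
  have hda : d ≠ a := hne (by simp [pawEdges])
  -- The triangle is oriented cyclically and `d` points to `a`; if `d` is `b` or `c`, the rule of
  -- the triangle applies.
  refine ⟨fun v => if v = a then b else if v = b then c else a, fun v hv => ?_⟩
  simp only [pawVertices, pawEdges, Finset.mem_insert, Finset.mem_singleton] at hv ⊢
  by_cases hva : v = a
  · subst hva
    simp [hab.symm, hca]
  by_cases hvb : v = b
  · subst hvb
    simp [hva, hca, hbc.symm, hab]
  · simp only [hva, hvb, if_false, if_true, true_or, true_and]
    refine ⟨fun h => hvb h.symm, ?_⟩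
    rcases hv with h | h | h | h
    · exact absurd h hva
    · exact absurd h hvb
    · subst h; simp
    · subst h; simp

/-- Either `y` is one of the at most `k` old vertices, or it costs a factor `q`, summed over at most
`Fintype.card V` choices. -/
lemma sum_pow_card_insert_le [Fintype V] {q c : ℝ} (hq : 0 ≤ q) (hqc : Fintype.card V * q ≤ c)
    {k : ℕ} {U : Finset V} (hU : U.card ≤ k) :
    ∑ y : V, q ^ (insert y U).card ≤ (k + c) * q ^ U.card := by
  have h1 : ∀ y : V, q ^ (insert y U).card ≤
      (if y ∈ U then q ^ U.card else 0) + q * q ^ U.card := by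
    intro y
    by_cases hy : y ∈ U
    · rw [Finset.insert_eq_of_mem hy, if_pos hy]
      exact le_add_of_nonneg_right (by positivity)
    · rw [Finset.card_insert_of_notMem hy, if_neg hy, pow_succ']
      simp
  calc ∑ y : V, q ^ (insert y U).card
      ≤ ∑ y : V, ((if y ∈ U then q ^ U.card else 0) + q * q ^ U.card) :=
        Finset.sum_le_sum fun y _ => h1 y
    _ = (U.card + Fintype.card V * q) * q ^ U.card := by
        rw [Finset.sum_add_distrib, Finset.sum_ite_mem, Finset.univ_inter, Finset.sum_const,
          Finset.sum_const, Finset.card_univ]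
        simp only [nsmul_eq_mul]
        ring
    _ ≤ _ := by gcongr

lemma sum_pow_card_union_pawVertices_le [Fintype V] {q c : ℝ} (hq : 0 ≤ q) (hc : 0 ≤ c)
    (hqc : Fintype.card V * q ≤ c) {k : ℕ} {U : Finset V} (hU : U.card ≤ k) :
    ∑ x : V × V × V × V, q ^ (U ∪ pawVertices x).card ≤ ((k + 3 : ℕ) + c) ^ 4 * q ^ U.card := by
  have hpos : (0 : ℝ) ≤ (k + 3 : ℕ) + c := by positivity
  have step : ∀ W : Finset V, W.card ≤ k + 3 →
      ∑ y : V, q ^ (insert y W).card ≤ ((k + 3 : ℕ) + c) * q ^ W.card :=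
    fun W hW => sum_pow_card_insert_le hq hqc hW
  have hins : ∀ (W : Finset V) (y : V) (m : ℕ), W.card ≤ m → (insert y W).card ≤ m + 1 :=
    fun W y m h => (Finset.card_insert_le y W).trans (by omega)
  have hunion : ∀ a b c d : V,
      U ∪ pawVertices (a, b, c, d) = insert d (insert c (insert b (insert a U))) := by
    intro a b c d
    ext z
    simp only [pawVertices, Finset.mem_union, Finset.mem_insert, Finset.mem_singleton]
    tauto
  simp only [Fintype.sum_prod_type, hunion]
  set C : ℝ := (k + 3 : ℕ) + c
  calc ∑ a : V, ∑ b : V, ∑ c : V, ∑ d : V, q ^ (insert d (insert c (insert b (insert a U)))).card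
      ≤ ∑ a : V, ∑ b : V, ∑ c : V, C * q ^ (insert c (insert b (insert a U))).card := by
        gcongr with a _ b _ c _
        exact step _ (hins _ _ _ (hins _ _ _ (hins _ _ _ hU)))
    _ ≤ ∑ a : V, ∑ b : V, C * (C * q ^ (insert b (insert a U)).card) := by
        gcongr with a _ b _
        rw [← Finset.mul_sum]
        gcongr
        exact step _ ((hins _ _ _ (hins _ _ _ hU)).trans (by omega))
    _ ≤ ∑ a : V, C * (C * (C * q ^ (insert a U).card)) := by
        gcongr with a _
        rw [← Finset.mul_sum, ← Finset.mul_sum]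
        gcongr
        exact step _ ((hins _ _ _ hU).trans (by omega))
    _ ≤ C * (C * (C * (C * q ^ U.card))) := by
        rw [← Finset.mul_sum, ← Finset.mul_sum, ← Finset.mul_sum]
        gcongr
        exact step _ (hU.trans (by omega))
    _ = C ^ 4 * q ^ U.card := by ring

/-- The second moment of the number of triangles with a pendant edge is bounded. -/
lemma integral_card_paws_sq_le [Fintype V] (p : unitInterval) {c : ℝ} (hc : 0 ≤ c)
    (hp : Fintype.card V * (p : ℝ) ≤ c) :
    ∫ G : SimpleGraph V, ((paws G).card : ℝ) ^ 2 ∂(SimpleGraph.binomialRandom V p) ≤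
      (c + 7) ^ 8 := by
  classical
  have hp0 : (0 : ℝ) ≤ p := p.2.1
  have hp1 : (p : ℝ) ≤ 1 := p.2.2
  have hcard : ∀ G : SimpleGraph V, ((paws G).card : ℝ) ^ 2 =
      ∑ x : V × V × V × V, ∑ y : V × V × V × V,
        if ((pawEdges x ∪ pawEdges y : Finset (Sym2 V)) : Set (Sym2 V)) ⊆ G.edgeSet
          then (1 : ℝ) else 0 := by
    intro G
    have h1 : ((paws G).card : ℝ) = ∑ x : V × V × V × V, if x ∈ paws G then (1 : ℝ) else 0 := by
      simp
    rw [sq, h1, Finset.sum_mul_sum]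
    refine Finset.sum_congr rfl fun x _ => Finset.sum_congr rfl fun y _ => ?_
    rw [Finset.coe_union, Set.union_subset_iff, ← mem_paws_iff, ← mem_paws_iff]
    by_cases hx : x ∈ paws G <;> by_cases hy : y ∈ paws G <;> simp [hx, hy]
  have hterm : ∀ x y : V × V × V × V,
      ∫ G : SimpleGraph V,
        (if ((pawEdges x ∪ pawEdges y : Finset (Sym2 V)) : Set (Sym2 V)) ⊆ G.edgeSet
          then (1 : ℝ) else 0) ∂(SimpleGraph.binomialRandom V p) ≤
        (p : ℝ) ^ (pawVertices x ∪ pawVertices y).card := by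
    intro x y
    -- The probability is `p` to the number of edges, which is at least the number of vertices; a
    -- pair of quadruples with a loop has probability zero.
    by_cases hT : pawEdges x ∪ pawEdges y ⊆ allEdges V
    · rw [integral_subset_edgeSet p hT]
      obtain ⟨f, hf⟩ := exists_paw_orientation (Finset.union_subset_left hT)
      obtain ⟨f', hf'⟩ := exists_paw_orientation (Finset.union_subset_right hT)
      exact pow_le_pow_of_le_one hp0 hp1 (card_union_le_of_orientation hf hf')
    · have hzero : ∀ G : SimpleGraph V,
          ¬ ((pawEdges x ∪ pawEdges y : Finset (Sym2 V)) : Set (Sym2 V)) ⊆ G.edgeSet :=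
        fun G hG => hT fun e he => mem_allEdges.2 (G.not_isDiag_of_mem_edgeSet (hG he))
      simp only [hzero, if_false, integral_zero]
      positivity
  have h4 : ∀ x : V × V × V × V, (pawVertices x).card ≤ 4 := fun x => Finset.card_le_four
  have hswap : ∫ G : SimpleGraph V, ((paws G).card : ℝ) ^ 2 ∂(SimpleGraph.binomialRandom V p) =
      ∑ x : V × V × V × V, ∑ y : V × V × V × V, ∫ G : SimpleGraph V,
        (if ((pawEdges x ∪ pawEdges y : Finset (Sym2 V)) : Set (Sym2 V)) ⊆ G.edgeSet
          then (1 : ℝ) else 0) ∂(SimpleGraph.binomialRandom V p) := by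
    simp only [hcard]
    rw [integral_finsetSum _ fun x _ => Integrable.of_finite]
    exact Finset.sum_congr rfl fun x _ => integral_finsetSum _ fun y _ => Integrable.of_finite
  rw [hswap]
  calc _ ≤ ∑ x : V × V × V × V, ∑ y : V × V × V × V,
        (p : ℝ) ^ (pawVertices x ∪ pawVertices y).card :=
        Finset.sum_le_sum fun x _ => Finset.sum_le_sum fun y _ => hterm x y
    -- The sum over `y` starts from the at most four vertices of `x`; the sum over `x` starts from
    -- the empty set.
    _ ≤ ∑ x : V × V × V × V, ((4 + 3 : ℕ) + c) ^ 4 * (p : ℝ) ^ (∅ ∪ pawVertices x).card := by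
        refine Finset.sum_le_sum fun x _ => ?_
        rw [Finset.empty_union]
        exact sum_pow_card_union_pawVertices_le hp0 hc hp (h4 x)
    _ ≤ ((4 + 3 : ℕ) + c) ^ 4 * (((0 + 3 : ℕ) + c) ^ 4 * (p : ℝ) ^ (∅ : Finset V).card) := by
        rw [← Finset.mul_sum]
        gcongr
        exact sum_pow_card_union_pawVertices_le hp0 hc hp (by simp)
    _ ≤ (c + 7) ^ 4 * ((c + 7) ^ 4 * 1) := by
        have h7 : ((4 + 3 : ℕ) : ℝ) + c ≤ c + 7 := by push_cast; linarith
        have h3 : ((0 + 3 : ℕ) : ℝ) + c ≤ c + 7 := by push_cast; linarith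
        rw [Finset.card_empty, pow_zero]
        gcongr
    _ = _ := by ring

/-- Markov's inequality for the square: for `m` of order `√n`, the first moment would only give
`O(1/√n)`. -/
lemma measureReal_le_card_paws [Fintype V] (p : unitInterval) {c m : ℝ} (hc : 0 ≤ c)
    (hp : Fintype.card V * (p : ℝ) ≤ c) (hm : 0 < m) :
    (SimpleGraph.binomialRandom V p).real {G | m ≤ ((paws G).card : ℝ)} ≤
      (c + 7) ^ 8 / m ^ 2 := by
  rw [le_div_iff₀ (by positivity), mul_comm]
  refine le_trans ?_ (integral_card_paws_sq_le p hc hp)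
  refine le_trans ?_ (mul_meas_ge_le_integral_of_nonneg
    (Eventually.of_forall fun G => by positivity) Integrable.of_finite (m ^ 2))
  refine mul_le_mul_of_nonneg_left (measureReal_mono
    (s₂ := {G : SimpleGraph V | m ^ 2 ≤ ((paws G).card : ℝ) ^ 2}) fun G hG => ?_) (by positivity)
  exact pow_le_pow_left₀ hm.le (show m ≤ _ from hG) 2

lemma integral_card_paws_le [Fintype V] (p : unitInterval) {c : ℝ} (hc : 0 ≤ c)
    (hp : Fintype.card V * (p : ℝ) ≤ c) :
    ∫ G : SimpleGraph V, ((paws G).card : ℝ) ∂(SimpleGraph.binomialRandom V p) ≤ (c + 7) ^ 8 := by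
  refine le_trans (integral_mono Integrable.of_finite Integrable.of_finite fun G => ?_)
    (integral_card_paws_sq_le p hc hp)
  show ((paws G).card : ℝ) ≤ ((paws G).card : ℝ) ^ 2
  exact_mod_cast Nat.le_self_pow two_ne_zero (paws G).card

end Paws

/-! ### Concentration of the peeling count -/

section Concentration

/-- The number of vertices with a neighbour after `t` rounds of peeling, as a function of the
edges. -/
noncomputable abbrev peelCount {V : Type*} (t : ℕ) (S : Finset (Sym2 V)) : ℝ :=
  ((peelSupport (SimpleGraph.fromEdgeSet (S : Set (Sym2 V))) t).ncard : ℝ)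

lemma fromEdgeSet_erase_le_insert {V : Type*} [DecidableEq V] (e : Sym2 V) (S : Finset (Sym2 V)) :
    SimpleGraph.fromEdgeSet ((S.erase e : Finset (Sym2 V)) : Set (Sym2 V)) ≤
      SimpleGraph.fromEdgeSet ((insert e S : Finset (Sym2 V)) : Set (Sym2 V)) := by
  refine SimpleGraph.fromEdgeSet_mono ?_
  exact Finset.coe_subset.2 ((Finset.erase_subset e S).trans (Finset.subset_insert e S))

lemma fromEdgeSet_insert_adj {V : Type*} [DecidableEq V] (e : Sym2 V) (S : Finset (Sym2 V))
    (a b : V) (h : (SimpleGraph.fromEdgeSet ((insert e S : Finset (Sym2 V)) : Set (Sym2 V))).Adj a b) :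
    (SimpleGraph.fromEdgeSet ((S.erase e : Finset (Sym2 V)) : Set (Sym2 V))).Adj a b ∨
      s(a, b) = e := by
  simp only [SimpleGraph.fromEdgeSet_adj, Finset.coe_insert, Set.mem_insert_iff, Finset.mem_coe,
    Finset.coe_erase, Set.mem_sdiff, Set.mem_singleton_iff] at h ⊢
  tauto

lemma peelSupport_diff_nonneg {V : Type*} [DecidableEq V] [Finite V] (t : ℕ) (e : Sym2 V)
    (S : Finset (Sym2 V)) :
    0 ≤ peelCount t (insert e S) -
      peelCount t (S.erase e) := by
  rw [sub_nonneg]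
  exact_mod_cast Set.ncard_le_ncard (peelSupport_mono (fromEdgeSet_erase_le_insert e S) t)

lemma peelSupport_diff_le {V : Type*} [DecidableEq V] [Finite V] (t : ℕ) (e : Sym2 V)
    (S : Finset (Sym2 V)) :
    peelCount t (insert e S) -
      peelCount t (S.erase e) ≤
        2 * (t + 1) := by
  rw [sub_le_iff_le_add']
  induction e using Sym2.ind with
  | h u v => exact_mod_cast ncard_peelSupport_le_add (fromEdgeSet_insert_adj s(u, v) S) t

lemma abs_peelSupport_diff_le {V : Type*} [DecidableEq V] [Finite V] (t : ℕ) (e : Sym2 V)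
    (S : Finset (Sym2 V)) :
    |peelCount t (insert e S) -
      peelCount t (S.erase e)| ≤
        2 * (t + 1) := by
  rw [abs_of_nonneg (peelSupport_diff_nonneg t e S)]
  exact peelSupport_diff_le t e S

lemma mul_card_allEdges_le {n : ℕ} {c : ℝ} (hc : 0 ≤ c) {p : unitInterval} (hn : 0 < n)
    (hp : (p : ℝ) = c / n) : (p : ℝ) * (allEdges (Fin n)).card ≤ c * n / 2 := by
  have hn' : (0 : ℝ) < n := by exact_mod_cast hn
  rw [card_allEdges, Fintype.card_fin, Nat.cast_choose_two, hp]
  rw [show c / (n : ℝ) * (n * (n - 1) / 2) = c * (n - 1) / 2 by field_simp]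
  nlinarith

/-- Concentration of the number of vertices left after `t` rounds of peeling. -/
lemma peelSupport_concentration {n : ℕ} {c : ℝ} (hc : 0 < c) {p : unitInterval} (hn : 0 < n)
    (hp : (p : ℝ) = c / n) (t : ℕ) {W x : ℝ} (hW : c * n / 2 * (2 * (t + 1)) ^ 2 ≤ W)
    (hx : 0 ≤ x) :
    (SimpleGraph.binomialRandom (Fin n) p).real
        {G | x ≤ |((peelSupport G t).ncard : ℝ) -
          ∫ H, ((peelSupport H t).ncard : ℝ) ∂(SimpleGraph.binomialRandom (Fin n) p)|} ≤
      2 * Real.exp (-(x ^ 2 / (2 * (W + 2 * (t + 1) * x / 3)))) := by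
  have hn' : (0 : ℝ) < n := by exact_mod_cast hn
  have hW0 : 0 < W := lt_of_lt_of_le (by positivity) hW
  refine measureReal_le_abs_sub_integral p (F := fun G => ((peelSupport G t).ncard : ℝ))
    (M := 2 * (t + 1)) (u := allEdges (Fin n)) (w := ∅) (by positivity) le_rfl hW0 hx
    (Finset.disjoint_empty_right _) (Finset.empty_union _)
    (fun e _ S => abs_peelSupport_diff_le t e S) (fun e he => absurd he (Finset.notMem_empty e)) ?_
  refine le_trans ?_ hW
  have := mul_card_allEdges_le hc.le hn hp
  rw [Finset.card_empty, Nat.cast_zero, zero_mul, add_zero, ← mul_assoc]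
  gcongr

/-- If `f ≥ 0` equals one either when no element of `a` is present or whenever one is, its average
over `a` is bounded below. -/
lemma le_bernoulliAvg_of_eq_one {ι : Type*} [DecidableEq ι] {p q : ℝ} (h0 : 0 ≤ p) (h1 : p ≤ 1)
    {a : Finset ι} {f : Finset ι → ℝ} (hf : ∀ S, 0 ≤ f S) {S : Finset ι}
    (h : f (S \ a) = 1 ∨ ∀ T ⊆ a, T.Nonempty → f (T ∪ S \ a) = 1)
    (hq : q ≤ (1 - p) ^ a.card) (hq' : q ≤ 1 - (1 - p) ^ a.card) :
    q ≤ bernoulliAvg p a f S := by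
  have h1' := sub_nonneg.2 h1
  have hempty : ∅ ∈ a.powerset := Finset.empty_mem_powerset a
  -- In the first case the term `T = ∅` alone suffices; in the second all other terms contribute,
  -- with total weight `1 - (1 - p) ^ a.card`.
  rcases h with h | h
  · refine hq.trans ?_
    refine le_trans (le_of_eq ?_) (Finset.single_le_sum (f := fun T =>
      p ^ T.card * (1 - p) ^ (a \ T).card * f (T ∪ S \ a)) (fun T _ => ?_) hempty)
    · simp [h]
    · have := hf (T ∪ S \ a)
      positivity
  · refine hq'.trans ?_
    have hone := bernoulliAvg_const p a 1 S
    unfold bernoulliAvg at hone ⊢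
    rw [← Finset.add_sum_erase _ _ hempty] at hone ⊢
    have hsum : ∑ T ∈ a.powerset.erase ∅, p ^ T.card * (1 - p) ^ (a \ T).card * f (T ∪ S \ a) =
        ∑ T ∈ a.powerset.erase ∅, p ^ T.card * (1 - p) ^ (a \ T).card * 1 := by
      refine Finset.sum_congr rfl fun T hT => ?_
      rw [Finset.mem_erase, Finset.mem_powerset] at hT
      rw [h T hT.2 (Finset.nonempty_iff_ne_empty.2 hT.1)]
    rw [hsum]
    simp only [Finset.card_empty, pow_zero, Finset.sdiff_empty, one_mul, mul_one] at hone ⊢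
    have := mul_nonneg (pow_nonneg h1' a.card) (hf (∅ ∪ S \ a))
    linarith

/-- Averaging over edges `a` at `u` makes it unlikely that `u` is a leaf. -/
lemma bernoulliAvg_peelSupport_one_diff_le {V : Type*} [DecidableEq V] [Finite V] {p q : ℝ}
    (h0 : 0 ≤ p) (h1 : p ≤ 1) {u v : V} {a w : Finset (Sym2 V)} (haw : a ⊆ w)
    (ha : ∀ e ∈ a, ∃ z, z ≠ u ∧ e = s(u, z) ∧ z ≠ v)
    (hq : q ≤ (1 - p) ^ a.card) (hq' : q ≤ 1 - (1 - p) ^ a.card) (S : Finset (Sym2 V)) :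
    bernoulliAvg p w (fun S =>
      peelCount 1 (insert s(u, v) S) -
      peelCount 1 (S.erase s(u, v)))
      S ≤ 4 - q := by
  classical
  set N : Finset (Sym2 V) → Set V := fun S =>
    (SimpleGraph.fromEdgeSet ((S.erase s(u, v) : Finset (Sym2 V)) : Set (Sym2 V))).neighborSet u
    with hN
  set g : Finset (Sym2 V) → ℝ := fun S => if (N S).ncard = 1 then 0 else 1 with hg
  have hmemN : ∀ S z, z ∈ N S ↔ s(u, z) ∈ S ∧ s(u, z) ≠ s(u, v) ∧ u ≠ z := by
    intro S z
    simp only [hN, SimpleGraph.mem_neighborSet, SimpleGraph.fromEdgeSet_adj, Finset.coe_erase,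
      Set.mem_sdiff, Finset.mem_coe, Set.mem_singleton_iff]
    tauto
  have hgavg : ∀ S, q ≤ bernoulliAvg p a g S := by
    intro S
    refine le_bernoulliAvg_of_eq_one h0 h1 (fun S => by simp only [hg]; split_ifs <;> norm_num)
      ?_ hq hq'
    -- If `u` has exactly one neighbour apart from `v` and the edges of `a`, any edge of `a` adds a
    -- second one; otherwise the absence of `a` keeps `u` from being a leaf.
    by_cases hcard : (N (S \ a)).ncard = 1
    · right
      intro T hT hTne
      refine if_neg fun hone => ?_
      obtain ⟨z, hz⟩ := Set.ncard_eq_one.1 hcard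
      obtain ⟨z', hz'⟩ := Set.ncard_eq_one.1 hone
      obtain ⟨e, he⟩ := hTne
      obtain ⟨y, hyu, rfl, hyv⟩ := ha e (hT he)
      have hzS := (hmemN _ _).1 (hz ▸ Set.mem_singleton z : z ∈ N (S \ a))
      have h1 : z ∈ N (T ∪ S \ a) :=
        (hmemN _ _).2 ⟨Finset.mem_union_right _ hzS.1, hzS.2.1, hzS.2.2⟩
      have h2 : y ∈ N (T ∪ S \ a) :=
        (hmemN _ _).2 ⟨Finset.mem_union_left _ he, fun h => hyv (Sym2.congr_right.1 h), hyu.symm⟩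
      rw [hz', Set.mem_singleton_iff] at h1 h2
      have hzy : z = y := h1.trans h2.symm
      rw [hzy] at hzS
      exact (Finset.mem_sdiff.1 hzS.1).2 (hT he)
    · exact Or.inl (if_neg hcard)
  have hdiff : ∀ S : Finset (Sym2 V),
      peelCount 1 (insert s(u, v) S) -
      peelCount 1 (S.erase s(u, v)) ≤
        4 - g S := by
    intro S
    simp only [hg]
    split_ifs with hcard
    · have := peelSupport_diff_le 1 s(u, v) S
      push_cast at this
      linarith
    · have : peelCount 1 (insert s(u, v) S) ≤
          peelCount 1 (S.erase s(u, v)) + 3 := by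
        exact_mod_cast ncard_peelSupport_one_le_add_three (fromEdgeSet_insert_adj s(u, v) S) hcard
      linarith
  calc _ ≤ bernoulliAvg p w (fun S => 4 - g S) S := bernoulliAvg_mono h0 h1 w hdiff S
    _ = 4 - bernoulliAvg p w g S := by rw [bernoulliAvg_sub, bernoulliAvg_const]
    _ ≤ 4 - q := by
        rw [← Finset.sdiff_union_of_subset haw, bernoulliAvg_union p Finset.sdiff_disjoint]
        have := le_bernoulliAvg_of_le h0 h1 (w \ a) hgavg S
        linarith

end Concentration

/-! ### The variance gain for one round, and all `t ≥ 1` -/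

section OneRound

/-- For one round of peeling the variance proxy can be improved by a constant factor. -/
lemma peelSupport_one_concentration {n : ℕ} {c : ℝ} (hc : 1 < c) {p : unitInterval}
    (hn : 4 * c ≤ n) (hp : (p : ℝ) = c / n) {x : ℝ} (hx : 0 ≤ x) :
    (SimpleGraph.binomialRandom (Fin n) p).real
        {G | x ≤ |((peelSupport G 1).ncard : ℝ) -
          ∫ H, ((peelSupport H 1).ncard : ℝ) ∂(SimpleGraph.binomialRandom (Fin n) p)|} ≤
      2 * Real.exp (-(x ^ 2 / (2 * (99 / 100 * (c * n / 2 * 4 ^ 2) + 4 * x / 3)))) := by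
  have hc0 : 0 < c := by linarith
  have hn0 : (0 : ℝ) < n := by linarith
  have hnpos : 0 < n := by exact_mod_cast hn0
  have hp0 : (0 : ℝ) ≤ p := p.2.1
  have hp1 : (p : ℝ) ≤ 1 := p.2.2
  -- The first `m` vertices are set apart, with `1/4 ≤ m p ≤ 1/2`: from any other vertex, the edges
  -- to them are all absent with probability between `1/5` and `4/5`. The differences improve along
  -- `w`, the edges among the other vertices.
  set m : ℕ := ⌊(n : ℝ) / (2 * c)⌋₊ with hm
  have hm_le : (m : ℝ) ≤ n / (2 * c) := Nat.floor_le (by positivity)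
  have hm_gt : (n : ℝ) / (2 * c) - 1 < m := Nat.sub_one_lt_floor _
  have hmp_le : (m : ℝ) * p ≤ 1 / 2 := by
    calc (m : ℝ) * p ≤ n / (2 * c) * (c / n) := by rw [hp]; gcongr
      _ = 1 / 2 := by field_simp
  have hmp_ge : 1 / 4 ≤ (m : ℝ) * p := by
    have h1 : (n : ℝ) / (4 * c) ≤ m := by
      have h2 : 1 ≤ (n : ℝ) / (4 * c) := by rw [le_div_iff₀ (by positivity)]; linarith
      have h3 : (n : ℝ) / (2 * c) = n / (4 * c) + n / (4 * c) := by field_simp; norm_num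
      linarith
    calc (1 / 4 : ℝ) = n / (4 * c) * (c / n) := by field_simp
      _ ≤ m * p := by rw [hp]; gcongr
  have hmn : (m : ℝ) ≤ n / 2 := hm_le.trans (by gcongr; linarith)
  have hmn' : m ≤ n := by
    have : (m : ℝ) ≤ n := by linarith
    exact_mod_cast this
  set Up : Finset (Fin n) := Finset.univ.filter fun i => m ≤ i.val with hUp
  have hUpcard : Up.card = n - m := by
    have h1 : (Finset.univ.filter fun i : Fin n => ¬ m ≤ i.val).card = m := by
      simp only [not_le]
      rw [Fin.card_filter_val_lt]
      omega
    have h2 : Up.card + (Finset.univ.filter fun i : Fin n => ¬ m ≤ i.val).card = n := by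
      rw [hUp, Finset.card_filter_add_card_filter_not, Finset.card_univ, Fintype.card_fin]
    omega
  set w : Finset (Sym2 (Fin n)) := Up.offDiag.image (fun x => s(x.1, x.2)) with hw
  have hwsub : w ⊆ allEdges (Fin n) := by
    intro e he
    obtain ⟨⟨a, b⟩, hab, rfl⟩ := Finset.mem_image.1 he
    rw [mem_allEdges]
    simpa using (Finset.mem_offDiag.1 hab).2.2
  have hwcard : w.card = (n - m).choose 2 := by
    rw [← hUpcard]
    exact Sym2.card_image_offDiag Up
  set u := allEdges (Fin n) \ w with hu
  have hucard : (u.card : ℝ) + w.card = (allEdges (Fin n)).card := by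
    exact_mod_cast Finset.card_sdiff_add_card_eq_card hwsub
  have hw_ge : (n : ℝ) ^ 2 / 16 ≤ w.card := by
    rw [hwcard, Nat.cast_choose_two, Nat.cast_sub hmn']
    have h4 : (4 : ℝ) ≤ n := by linarith
    nlinarith
  have hall : (p : ℝ) * (allEdges (Fin n)).card ≤ c * n / 2 :=
    mul_card_allEdges_le hc0.le hnpos hp
  have hpow_ge : (1 / 5 : ℝ) ≤ (1 - p) ^ m := by
    have := one_add_mul_le_pow (a := -(p : ℝ)) (by linarith) m
    rw [← sub_eq_add_neg] at this
    linarith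
  have hpow_le : (1 / 5 : ℝ) ≤ 1 - (1 - p) ^ m := by
    have h1 : (1 - (p : ℝ)) ^ m ≤ Real.exp (-(1 / 4)) := by
      calc (1 - (p : ℝ)) ^ m ≤ (Real.exp (-p)) ^ m := by
            have := Real.add_one_le_exp (-(p : ℝ))
            exact pow_le_pow_left₀ (by linarith) (by linarith) m
        _ = Real.exp (-(m * p)) := by rw [← Real.exp_nat_mul]; ring_nf
        _ ≤ _ := by gcongr
    have h2 : Real.exp (-(1 / 4)) ≤ 4 / 5 := by
      rw [Real.exp_neg, inv_le_comm₀ (Real.exp_pos _) (by norm_num)]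
      have := Real.add_one_le_exp (1 / 4 : ℝ)
      linarith
    linarith
  have h := measureReal_le_abs_sub_integral p (F := fun G => ((peelSupport G 1).ncard : ℝ))
    (L := 4) (M := 4 - 1 / 5) (W := 99 / 100 * (c * n / 2 * 4 ^ 2)) (x := x) (u := u) (w := w)
    (by norm_num) (by norm_num) (by positivity) hx Finset.sdiff_disjoint
    (by rw [Finset.union_comm]; exact Finset.sdiff_union_of_subset hwsub) ?_ ?_ ?_
  · exact h
  · intro e _ S
    exact (abs_peelSupport_diff_le 1 e S).trans (by norm_num)
  · intro e he S
    obtain ⟨⟨y, z⟩, hyz, rfl⟩ := Finset.mem_image.1 he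
    simp only [Finset.mem_offDiag, hUp, Finset.mem_filter, Finset.mem_univ, true_and] at hyz
    rw [abs_of_nonneg (le_bernoulliAvg_of_le hp0 hp1 u
      (fun S => peelSupport_diff_nonneg 1 s(y, z) S) S)]
    set a : Finset (Sym2 (Fin n)) :=
      (Finset.univ.filter fun i : Fin n => i.val < m).image fun i => s(y, i) with ha
    have hacard : a.card = m := by
      rw [ha, Finset.card_image_of_injective _ fun i j h => Sym2.congr_right.1 h,
        Fin.card_filter_val_lt]
      omega
    refine bernoulliAvg_peelSupport_one_diff_le hp0 hp1 (a := a) ?_ ?_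
      (by rw [hacard]; exact hpow_ge) (by rw [hacard]; exact hpow_le) S
    · intro e he
      obtain ⟨i, hi, rfl⟩ := Finset.mem_image.1 he
      have hi : i.val < m := by simpa using hi
      refine Finset.mem_sdiff.2 ⟨?_, fun hmem => ?_⟩
      · rw [mem_allEdges]
        simp only [Sym2.mk_isDiag_iff]
        rintro rfl
        omega
      · obtain ⟨⟨b, d⟩, hbd, heq⟩ := Finset.mem_image.1 hmem
        simp only [Finset.mem_offDiag, hUp, Finset.mem_filter, Finset.mem_univ, true_and] at hbd
        rcases Sym2.eq_iff.1 heq with ⟨h1, h2⟩ | ⟨h1, h2⟩ <;> simp only at h1 h2 <;> subst h1 h2 <;>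
          omega
    · intro e he
      obtain ⟨i, hi, rfl⟩ := Finset.mem_image.1 he
      have hi : i.val < m := by simpa using hi
      refine ⟨i, ?_, rfl, ?_⟩ <;> rintro rfl <;> omega
  -- Replacing `4 ^ 2` by `(4 - 1/5) ^ 2 = 14.44` along `w` saves at least `1.56 * (c n / 16)`, more
  -- than a hundredth of `8 c n`.
  · have hpw : c * n / 16 ≤ p * w.card := by
      calc c * n / 16 = p * ((n : ℝ) ^ 2 / 16) := by rw [hp]; field_simp
        _ ≤ _ := by gcongr
    have : (p : ℝ) * u.card + p * w.card = p * (allEdges (Fin n)).card := by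
      rw [← mul_add, hucard]
    nlinarith

/-- Concentration of the number of vertices left after at least one round of peeling. -/
lemma peelSupport_concentration_improved {n : ℕ} {c : ℝ} (hc : 1 < c) {p : unitInterval}
    (hn : 4 * c ≤ n) (hp : (p : ℝ) = c / n) {t : ℕ} (ht : 1 ≤ t) {x : ℝ} (hx : 0 ≤ x) :
    (SimpleGraph.binomialRandom (Fin n) p).real
        {G | x ≤ |((peelSupport G t).ncard : ℝ) -
          ∫ H, ((peelSupport H t).ncard : ℝ) ∂(SimpleGraph.binomialRandom (Fin n) p)|} ≤
      2 * Real.exp (-(x ^ 2 /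
        (2 * (99 / 100 * (c * n / 2 * 4 ^ (t + 1)) + 2 ^ (t + 1) * x / 3)))) := by
  have hn0 : (0 : ℝ) < n := by linarith
  rcases ht.eq_or_lt with rfl | ht
  · have := peelSupport_one_concentration hc hn hp hx
    norm_num at this ⊢
    exact this
  -- Equality holds at `k = 2`; what is needed is only that `(3/4) ^ 2 ≤ 99/100`.
  · have hpow' : ∀ k : ℕ, 2 ≤ k → 2 * ((k : ℝ) + 1) ≤ 3 / 4 * 2 ^ (k + 1) := by
      intro k hk
      induction k, hk using Nat.le_induction with
      | base => norm_num
      | succ k hk ih =>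
        have : (2 : ℝ) ^ 2 ≤ 2 ^ (k + 1) := pow_le_pow_right₀ (by norm_num) (by omega)
        rw [pow_succ]
        push_cast
        linarith
    have hpow := hpow' t ht
    have h4 : (4 : ℝ) ^ (t + 1) = (2 ^ (t + 1)) ^ 2 := by
      rw [← pow_mul, mul_comm, pow_mul]; norm_num
    have hW : c * n / 2 * (2 * ((t : ℝ) + 1)) ^ 2 ≤ 99 / 100 * (c * n / 2 * 4 ^ (t + 1)) := by
      have h1 : (2 * ((t : ℝ) + 1)) ^ 2 ≤ (3 / 4 * 2 ^ (t + 1)) ^ 2 := by gcongr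
      have h2 : 0 ≤ c * n / 2 := by positivity
      have h3 : (0 : ℝ) ≤ 4 ^ (t + 1) := by positivity
      calc c * n / 2 * (2 * ((t : ℝ) + 1)) ^ 2 ≤ c * n / 2 * (99 / 100 * 4 ^ (t + 1)) := by
            refine mul_le_mul_of_nonneg_left (h1.trans ?_) h2
            rw [mul_pow, ← h4]
            nlinarith
        _ = _ := by ring
    refine (peelSupport_concentration (by linarith) (by exact_mod_cast hn0) hp t hW hx).trans ?_
    have hle : 2 * ((t : ℝ) + 1) ≤ 2 ^ (t + 1) := by
      have : (0 : ℝ) < 2 ^ (t + 1) := by positivity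
      linarith
    gcongr

end OneRound

/-! ### The tail bound in terms of the deviation -/

section Tail

/-- The tail bound with `A = 0` in terms of the deviation `x = s n ^ (2 / 3)`. -/
lemma tailBound_eq {c : ℝ} (hc : 0 < c) (t : ℕ) (B : ℝ) {n : ℕ} (hn : 0 < n) {s : ℝ} (hs : 0 ≤ s) :
    tailBound c t 0 B n s = 2 * Real.exp (-((s * (n : ℝ) ^ (2 / 3 : ℝ)) ^ 2 /
      (2 * (c * n / 2 * 4 ^ (t + 1) + 2 ^ (t + 1) * (s * (n : ℝ) ^ (2 / 3 : ℝ)) / 3)))) +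
        B / n := by
  have hn' : (0 : ℝ) < n := by exact_mod_cast hn
  -- In powers of `r`, the two fractions differ by the common factor `r ^ 3`.
  set r := (n : ℝ) ^ (1 / 3 : ℝ) with hr
  have hr0 : 0 < r := Real.rpow_pos_of_pos hn' _
  have h1 : (n : ℝ) ^ (2 / 3 : ℝ) = r ^ 2 := by
    rw [hr, ← Real.rpow_natCast, ← Real.rpow_mul hn'.le]; norm_num
  have h2 : (n : ℝ) = r ^ 3 := by
    rw [hr, ← Real.rpow_natCast, ← Real.rpow_mul hn'.le]; norm_num
  have h3 : (n : ℝ) ^ (-(1 / 3) : ℝ) = r⁻¹ := by rw [hr, Real.rpow_neg hn'.le]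
  unfold tailBound
  rw [h1, h3, ← hr, zero_div, add_zero]
  congr 4
  rw [h2]
  have hpos : 0 < c * 4 ^ (t + 1) + 2 / 3 * s * r⁻¹ * 2 ^ (t + 1) := by positivity
  have hpos' : 0 < 2 * (c * r ^ 3 / 2 * 4 ^ (t + 1) + 2 ^ (t + 1) * (s * r ^ 2) / 3) := by
    positivity
  rw [div_eq_div_iff hpos.ne' hpos'.ne']
  field_simp

lemma tendsto_tailBound {c : ℝ} (hc : 0 < c) (t : ℕ) (B : ℝ) {s : ℝ} (hs : 0 < s) :
    Tendsto (fun n : ℕ => tailBound c t 0 B n s) atTop (𝓝 0) := by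
  have hcast : Tendsto (fun n : ℕ => (n : ℝ)) atTop atTop := tendsto_natCast_atTop_atTop
  have h1 : Tendsto (fun n : ℕ => B / (n : ℝ)) atTop (𝓝 0) := hcast.const_div_atTop B
  have hD : Tendsto (fun n : ℕ => c * 4 ^ (t + 1) +
      (2 / 3) * s * (n : ℝ) ^ (-(1 / 3) : ℝ) * 2 ^ (t + 1) + 0 / (n : ℝ)) atTop
      (𝓝 (c * 4 ^ (t + 1) + (2 / 3) * s * 0 * 2 ^ (t + 1) + 0)) := by
    refine ((tendsto_const_nhds.add ((tendsto_const_nhds.mul ?_).mul_const _)).add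
      (hcast.const_div_atTop 0))
    exact (tendsto_rpow_neg_atTop (by norm_num : (0 : ℝ) < 1 / 3)).comp hcast
  have hN : Tendsto (fun n : ℕ => s ^ 2 * (n : ℝ) ^ (1 / 3 : ℝ)) atTop atTop :=
    ((tendsto_rpow_atTop (by norm_num : (0 : ℝ) < 1 / 3)).comp hcast).const_mul_atTop
      (by positivity)
  have hpos : 0 < c * 4 ^ (t + 1) + (2 / 3) * s * 0 * 2 ^ (t + 1) + 0 := by positivity
  have hdiv := hN.atTop_mul_pos (inv_pos.2 hpos) (hD.inv₀ hpos.ne')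
  have h2 := (Real.tendsto_exp_atBot.comp (tendsto_neg_atTop_atBot.comp hdiv)).const_mul 2
  have h3 := h2.add h1
  simpa [tailBound, Function.comp_def, div_eq_mul_inv] using h3

end Tail

/-! ### Concentration of the number of survivors -/

section Survivors

lemma survivors_nonneg {V : Type*} [DecidableEq V] (t : ℕ) (G : SimpleGraph V) :
    0 ≤ survivors t G := Nat.cast_nonneg _

lemma abs_survivors_sub_integral_le {n : ℕ} (t : ℕ) (p : unitInterval) (G : SimpleGraph (Fin n)) :
    |survivors t G - ∫ H, survivors t H ∂(SimpleGraph.binomialRandom (Fin n) p)| ≤ n := by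
  have h0 := survivors_nonneg t G
  have h1 := survivors_le_card t G
  have h2 : 0 ≤ ∫ H : SimpleGraph (Fin n), survivors t H ∂(SimpleGraph.binomialRandom (Fin n) p) :=
    integral_nonneg fun H => survivors_nonneg t H
  have h3 : ∫ H : SimpleGraph (Fin n), survivors t H ∂(SimpleGraph.binomialRandom (Fin n) p) ≤
      n := by
    refine (integral_mono Integrable.of_finite (integrable_const (n : ℝ)) fun H => ?_).trans ?_
    · simpa using survivors_le_card t H
    · simp
  rw [Fintype.card_fin] at h1
  exact abs_le.2 ⟨by linarith, by linarith⟩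

lemma abs_integral_survivors_sub_le {n : ℕ} (t : ℕ) (p : unitInterval) {c : ℝ} (hc : 0 ≤ c)
    (hp : n * (p : ℝ) ≤ c) :
    |∫ G : SimpleGraph (Fin n), survivors t G ∂(SimpleGraph.binomialRandom (Fin n) p) -
      ∫ G : SimpleGraph (Fin n), ((peelSupport G t).ncard : ℝ)
        ∂(SimpleGraph.binomialRandom (Fin n) p)| ≤ 2 * (t + 1) * (c + 7) ^ 8 := by
  rw [← integral_sub Integrable.of_finite Integrable.of_finite]
  calc _ ≤ ∫ G : SimpleGraph (Fin n), |survivors t G - ((peelSupport G t).ncard : ℝ)|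
        ∂(SimpleGraph.binomialRandom (Fin n) p) := abs_integral_le_integral_abs
    _ ≤ ∫ G : SimpleGraph (Fin n), 2 * ((t : ℝ) + 1) * (paws G).card
        ∂(SimpleGraph.binomialRandom (Fin n) p) :=
        integral_mono Integrable.of_finite Integrable.of_finite fun G =>
          abs_survivors_sub_ncard_peelSupport_le G t
    _ ≤ _ := by
        rw [integral_const_mul]
        gcongr
        exact integral_card_paws_le p hc (by simpa using hp)

/-- A better variance proxy makes up for a small loss in the deviation. -/
lemma div_le_div_of_improved_variance {W L x : ℝ} (hW : 0 < W) (hL : 0 ≤ L) (hx : 0 ≤ x)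
    (hxW : L * x / 3 ≤ W) :
    x ^ 2 / (2 * (W + L * x / 3)) ≤
      (399 / 400 * x) ^ 2 / (2 * (99 / 100 * W + L * (399 / 400 * x) / 3)) := by
  have hy : 0 ≤ L * x / 3 := by positivity
  set y := L * x / 3 with hy'
  have hrw : L * (399 / 400 * x) / 3 = 399 / 400 * y := by rw [hy']; ring
  rw [hrw, div_le_div_iff₀ (by positivity) (by positivity), mul_pow]
  -- Over the denominator `400 ^ 2`, the coefficient of `W` gains 801 and that of `y` loses 399,
  -- which `y ≤ W` pays for.
  have : 2 * (99 / 100 * W + 399 / 400 * y) ≤ (399 / 400) ^ 2 * (2 * (W + y)) := by nlinarith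
  calc x ^ 2 * (2 * (99 / 100 * W + 399 / 400 * y)) ≤
        x ^ 2 * ((399 / 400) ^ 2 * (2 * (W + y))) := by gcongr
    _ = _ := by ring

/-- Concentration of the number of survivors after at least one pruning phase. -/
lemma survivors_concentration {c : ℝ} (hc : 1 < c) {t : ℕ} (ht : 1 ≤ t) :
    ∃ B : ℝ, 0 ≤ B ∧ ∀ (n : ℕ) (p : unitInterval), 0 < n → (p : ℝ) = c / n → ∀ x : ℝ, 0 ≤ x →
      (SimpleGraph.binomialRandom (Fin n) p).real
          {G | x ≤ |survivors t G -
            ∫ H, survivors t H ∂(SimpleGraph.binomialRandom (Fin n) p)|} ≤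
        2 * Real.exp (-(x ^ 2 / (2 * (c * n / 2 * 4 ^ (t + 1) + 2 ^ (t + 1) * x / 3)))) + B / n := by
  have hc0 : 0 < c := by linarith
  set C : ℝ := (c + 7) ^ 8 with hC
  have hC0 : 0 < C := by positivity
  set k : ℝ := 2 * ((t : ℝ) + 1) with hk
  have hk0 : 0 < k := by positivity
  -- The first summand bounds the probability of `m` paws. When `n` exceeds the sum, the second
  -- gives `k C ≤ √n / 800` and the third `4 c ≤ n`; otherwise the claimed bound is at least `1`.
  refine ⟨C * (800 * k) ^ 2 + (800 * k * C) ^ 2 + 4 * c, by positivity,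
    fun n p hn hp x hx => ?_⟩
  set B := C * (800 * k) ^ 2 + (800 * k * C) ^ 2 + 4 * c with hB
  set μ := SimpleGraph.binomialRandom (Fin n) p with hμ
  have hn' : (0 : ℝ) < n := by exact_mod_cast hn
  set W := c * n / 2 * 4 ^ (t + 1) with hWdef
  have hW : 0 < W := by positivity
  have hexp : 0 ≤ 2 * Real.exp (-(x ^ 2 / (2 * (W + 2 ^ (t + 1) * x / 3)))) := by positivity
  have hBn : 0 ≤ B / n := by positivity
  rcases le_or_gt (n : ℝ) B with hnB | hnB
  · have h1 : 1 ≤ B / n := by rwa [le_div_iff₀ hn', one_mul]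
    exact (measureReal_le_one).trans (by linarith)
  have hn4 : 4 * c ≤ n := by
    have h1 : 0 ≤ C * (800 * k) ^ 2 := by positivity
    have h2 : 0 ≤ (800 * k * C) ^ 2 := by positivity
    linarith
  have h4pow : (4 : ℝ) ≤ 4 ^ (t + 1) := le_self_pow₀ (by norm_num) (by omega)
  -- For `x < √n` the exponential is at least `3/4`, so the bound exceeds `1`.
  rcases lt_or_ge x (Real.sqrt n) with hxs | hxs
  · have hx2 : x ^ 2 ≤ n := by
      calc x ^ 2 ≤ Real.sqrt n ^ 2 := by gcongr
        _ = (n : ℝ) := Real.sq_sqrt hn'.le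
    have hquot : x ^ 2 / (2 * (W + 2 ^ (t + 1) * x / 3)) ≤ 1 / 4 := by
      rw [div_le_iff₀ (by positivity)]
      have h1 : 0 ≤ 2 ^ (t + 1) * x / 3 := by positivity
      have h2 : 2 * (n : ℝ) ≤ W := by
        calc 2 * (n : ℝ) = 1 * n / 2 * 4 := by ring
          _ ≤ c * n / 2 * 4 ^ (t + 1) := by gcongr
      linarith
    have h1 := Real.add_one_le_exp (-(x ^ 2 / (2 * (W + 2 ^ (t + 1) * x / 3))))
    exact (measureReal_le_one).trans (by linarith)
  -- The count lies between `0` and `n`, so no deviation exceeds `n`.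
  rcases lt_or_ge (n : ℝ) x with hxn | hxn
  · have hempty : {G : SimpleGraph (Fin n) | x ≤ |survivors t G - ∫ H, survivors t H ∂μ|} = ∅ := by
      ext G
      simp only [Set.mem_ofPred_eq, Set.mem_empty_iff_false, iff_false, not_le]
      exact (abs_survivors_sub_integral_le t p G).trans_lt hxn
    rw [hempty, measureReal_empty]
    positivity
  have hsq : 0 < Real.sqrt n := Real.sqrt_pos.2 hn'
  -- Fewer than `m` paws change the count by at most `k m = √n / 800`, and the means differ by at
  -- most `k C ≤ √n / 800`; together this is at most `x / 400`.
  set m := Real.sqrt n / (800 * k) with hm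
  have hm0 : 0 < m := by positivity
  have hpn : n * (p : ℝ) ≤ c := by rw [hp]; field_simp; exact le_rfl
  have hkC : k * C ≤ Real.sqrt n / 800 := by
    rw [le_div_iff₀ (by norm_num)]
    refine Real.le_sqrt_of_sq_le ?_
    have h1 : 0 ≤ C * (800 * k) ^ 2 := by positivity
    calc (k * C * 800) ^ 2 = (800 * k * C) ^ 2 := by ring
      _ ≤ (n : ℝ) := by linarith
  have hkm : k * m = Real.sqrt n / 800 := by rw [hm]; field_simp
  have hsub : {G : SimpleGraph (Fin n) | x ≤ |survivors t G - ∫ H, survivors t H ∂μ|} ⊆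
      {G : SimpleGraph (Fin n) | 399 / 400 * x ≤ |((peelSupport G t).ncard : ℝ) -
        ∫ H, ((peelSupport H t).ncard : ℝ) ∂μ|} ∪ {G : SimpleGraph (Fin n) | m ≤ ((paws G).card : ℝ)} := by
    intro G hG
    have hG : x ≤ |survivors t G - ∫ H, survivors t H ∂μ| := hG
    rcases le_or_gt m ((paws G).card : ℝ) with h | h
    · exact Or.inr h
    refine Or.inl ?_
    show 399 / 400 * x ≤ _
    have h1 := abs_survivors_sub_ncard_peelSupport_le G t
    have h2 := abs_integral_survivors_sub_le t p hc0.le hpn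
    have h3 : k * ((paws G).card : ℝ) ≤ k * m := by gcongr
    set Y := survivors t G
    set F := ((peelSupport G t).ncard : ℝ)
    set EY := ∫ H, survivors t H ∂μ
    set EF := ∫ H, ((peelSupport H t).ncard : ℝ) ∂μ
    have htri : |Y - EY| ≤ |Y - F| + |F - EF| + |EY - EF| := by
      calc |Y - EY| = |(Y - F) + (F - EF) + (EF - EY)| := by congr 1; ring
        _ ≤ |Y - F| + |F - EF| + |EF - EY| := abs_add_three _ _ _
        _ = _ := by rw [abs_sub_comm EF EY]
    linarith
  have hpaws : μ.real {G : SimpleGraph (Fin n) | m ≤ ((paws G).card : ℝ)} ≤ B / n := by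
    refine (measureReal_le_card_paws p hc0.le (by simpa using hpn) hm0).trans ?_
    rw [← hC, hm, div_pow, Real.sq_sqrt hn'.le, div_div_eq_mul_div]
    gcongr
    have h2 : 0 ≤ (800 * k * C) ^ 2 := by positivity
    linarith
  have hpeel := peelSupport_concentration_improved hc hn4 hp ht
    (x := 399 / 400 * x) (by positivity)
  have hxW : 2 ^ (t + 1) * x / 3 ≤ W := by
    have h1 : (2 : ℝ) ^ (t + 1) ≤ 4 ^ (t + 1) := by gcongr; norm_num
    have h2 : (0 : ℝ) < 4 ^ (t + 1) := by positivity
    calc 2 ^ (t + 1) * x / 3 ≤ 4 ^ (t + 1) * n / 2 := by gcongr; norm_num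
      _ = 1 * n / 2 * 4 ^ (t + 1) := by ring
      _ ≤ W := by rw [hWdef]; gcongr
  calc _ ≤ _ := measureReal_mono hsub
    _ ≤ _ := measureReal_union_le _ _
    _ ≤ _ := add_le_add (hpeel.trans ?_) hpaws
  have := div_le_div_of_improved_variance hW (by positivity : (0 : ℝ) ≤ 2 ^ (t + 1)) hx hxW
  gcongr

end Survivors

end StrongCollapse

theorem theorem4 (c : ℝ) (hc : 1 < c) (t : ℕ) :
    ∃ A B : ℝ, 0 ≤ A ∧ 0 ≤ B ∧
      (∀ (n : ℕ) (p : unitInterval), 0 < n → (p : ℝ) = c / n → ∀ s : ℝ, 0 ≤ s →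
        (SimpleGraph.binomialRandom (Fin n) p).real
            {G | s * (n : ℝ) ^ (2 / 3 : ℝ) ≤
              |StrongCollapse.survivors t G -
                ∫ H, StrongCollapse.survivors t H ∂(SimpleGraph.binomialRandom (Fin n) p)|}
          ≤ StrongCollapse.tailBound c t A B n s) ∧
      ∀ s : ℝ, 0 < s →
        Tendsto (fun n : ℕ => StrongCollapse.tailBound c t A B n s) atTop (𝓝 0) := by
  have hc0 : 0 < c := by linarith
  -- For `t = 0` the comparison with peeling is exact and `2 (t + 1) = 2 ^ (t + 1)`, so Bernstein's
  -- inequality gives the bound with `B = 0`.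
  rcases Nat.eq_zero_or_pos t with rfl | ht
  · refine ⟨0, 0, le_rfl, le_rfl, fun n p hn hp s hs => ?_,
      fun s hs => StrongCollapse.tendsto_tailBound hc0 0 0 hs⟩
    rw [StrongCollapse.tailBound_eq hc0 0 0 hn hs, zero_div, add_zero]
    simp only [StrongCollapse.survivors_zero]
    have h := StrongCollapse.peelSupport_concentration hc0 hn hp 0 le_rfl
      (by positivity : 0 ≤ s * (n : ℝ) ^ (2 / 3 : ℝ))
    norm_num at h ⊢
    exact h
  · obtain ⟨B, hB, h⟩ := StrongCollapse.survivors_concentration hc ht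
    refine ⟨0, B, le_rfl, hB, fun n p hn hp s hs => ?_,
      fun s hs => StrongCollapse.tendsto_tailBound hc0 t B hs⟩
    rw [StrongCollapse.tailBound_eq hc0 t B hn hs]
    exact h n p hn hp _ (by positivity)
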